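/- Let $\Omega\subset\mathbb R^2$ be a bounded simply connected domain with $C^3$ boundary, and let $\gamma:[0,1]\to\partial\Omega$ be a $C^3$ positively oriented parametrization of $\partial\Omega$, closed and one-to-one on $[0,1)$. Let $L_1,L_2,L_3\in\mathbb R$ with $L_1>0$ and $L_1+L_2+L_3>0$, let $s\ne0$ and $\varepsilon>0$. Let $\mathcal S$ be the space of real symmetric traceless $3\times3$ matrices. *Bulk density.* Let $f_b:\mathcal S\to[0,\infty)$ be $C^\infty$, with $f_b(RQR^t)=f_b(Q)$ for all $R\in O(3)$, $Q\in\mathcal S$, and $f_b(Q)=0$ if and only if $Q=s(\mathbf m\otimes\mathbf m-\frac13I)$ for some unit vector $\mathbf m\in\mathbb R^3$. For $\mathbf p=(p_1,p_2)\in\mathbb R^2$ and $r\in\mathbb R$ put $$Q(\mathbf p,r)=\begin{bmatrix}p_1+\frac r2&p_2&0\\p_2&\frac r2-p_1&0\\0&0&-r\end{bmatrix}.$$ By the invariance of $f_b$ there is a function $g_b$ on $[0,\infty)\times\mathbb R$ with $f_b(Q(\mathbf p,r))=g_b(|\mathbf p|^2,r)$. Assume that $g_b=g_b(\mathfrak p,\mathfrak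 r)$ is $C^\infty$ on $[0,\infty)\times\mathbb R$, $g_b\ge0$, $g_b(\frac{s^2}4,\frac s3)=0$, and that there are $m_1,m_2,m_3,m_4,\delta>0$ such that, for all $\mathbf p,r$, $$|g_{b,\mathfrak p}(|\mathbf p|^2,r)|\,|\mathbf p|+|g_{b,\mathfrak r}(|\mathbf p|^2,r)|\le m_1(|\mathbf p|^3+|r|^3)+m_2,\qquad m_3(|\mathbf p|^4+|r|^4)-1\le g_b(|\mathbf p|^2,r),$$ and $m_4\big((|\mathbf p|^2-\frac{s^2}4)^2+|r-\frac s3|^2\big)\le g_b(|\mathbf p|^2,r)$ whenever $\big||\mathbf p|-\frac{|s|}2\big|+|r-\frac s3|<\delta$. *Boundary data.* Let $Q_0=s(\mathbf n_0\otimes\mathbf n_0-\frac13I)$ on $\partial\Omega$, where $\mathbf n_0=\langle n_1,n_2,0\rangle$ and $|\mathbf n_0|=1$, with entries of $Q_0$ in $C^3(\partial\Omega)$. Assume $\deg Q_0=\frac k2$ with $k$ a positive integer; here $\deg Q_0=\frac1{2\pi}\int_0^1\tilde{\mathbf n}^\perp\cdot\tilde{\mathbf n}'\,dt$ for a unit field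 $\tilde{\mathbf n}=\langle\tilde n_1,\tilde n_2,0\rangle\in C^1([0,1))$ with $Q_0(\gamma(t))=s(\tilde{\mathbf n}(t)\otimes\tilde{\mathbf n}(t)-\frac13I)$ and $\tilde{\mathbf n}^\perp=\langle-\tilde n_2,\tilde n_1,0\rangle$. Let $\mathbf p_0$ be given by $Q_0=Q(\mathbf p_0,\frac s3)$ on $\partial\Omega$, and let $$A_0=\{(\mathbf p,r)\in W^{1,2}(\Omega;\mathbb R^2)\times W^{1,2}(\Omega):\ \mathbf p=\mathbf p_0,\ r=\tfrac s3\text{ on }\partial\Omega\},$$ $$\mathcal M=\{Q\in W^{1,2}(\Omega;\mathbb R^{3\times3}):\ Q=Q_0\text{ on }\partial\Omega\},$$ boundary values being understood in the Sobolev (trace) sense. *Energies.* With $(x_1,x_2)=(x,y)$, $Q_{ij,3}=0$ and summation over repeated indices from $1$ to $3$, let $$F_\varepsilon(Q)=\int_\Omega\Big[\tfrac{L_1}2Q_{ij,k}Q_{ij,k}+\tfrac{L_2}2Q_{ij,j}Q_{ik,k}+\tfrac{L_3}2Q_{ij,k}Q_{ik,j}+\varepsilon^{-2}f_b(Q)\Big],$$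 $$G_\varepsilon(\mathbf p,r)=\int_\Omega\big[g_e(\nabla\mathbf p,\nabla r)+\varepsilon^{-2}g_b(|\mathbf p|^2,r)\big],$$ $$g_e=\big(L_1+\tfrac{L_2+L_3}2\big)|\nabla\mathbf p|^2+\big(\tfrac{3L_1}4+\tfrac{L_2+L_3}8\big)|\nabla r|^2+\tfrac{L_2+L_3}2(p_{1x}r_x-p_{1y}r_y+r_xp_{2y}+r_yp_{2x})+|L_2+L_3|(p_{1x}p_{2y}-p_{1y}p_{2x}),$$ and write $N(\nabla Q)=Q_{ij,k}Q_{ik,j}-Q_{ij,j}Q_{ik,k}$. Then for every $(\mathbf p,r)\in A_0$ and $Q=Q(\mathbf p,r)$, the integrands of $F_\varepsilon(Q)$ and $G_\varepsilon(\mathbf p,r)$, and also $N(\nabla Q)$ and $p_{1x}p_{2y}-p_{1y}p_{2x}$, are integrable on $\Omega$, and $$G_\varepsilon(\mathbf p,r)=F_\varepsilon(Q)+(L_3-L_2+|L_3+L_2|)\,\frac{s^2\pi k}4 .$$ Moreover, almost everywhere in $\Omega$, the integrand of $G_\varepsilon(\mathbf p,r)$ equals the integrand of $F_\varepsilon(Q)$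 minus $\frac{L_3-L_2+|L_3+L_2|}4N(\nabla Q)$. The density $N$ is a null Lagrangian: on $\mathcal M$ it is integrable, its integral over $\Omega$ is constant, and its first variation $\frac{d}{dt}\big|_{t=0}\int_\Omega N(\nabla(Q+tV))$ vanishes for all $Q\in\mathcal M$, $V\in W^{1,2}_0(\Omega;\mathbb R^{3\times3})$. Finally, $$\int_\Omega N(\nabla Q)=-4\int_\Omega(p_{1x}p_{2y}-p_{1y}p_{2x})=-s^2\pi k .$$ -/

import Mathlib

open MeasureTheory Set Filter Topology
open scoped ContDiff

noncomputable section

/-! The plane `ℝ²` is `ℂ`, with `x = re`, `y = im`; thus `∂/∂x` is the derivative in the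
direction `1` and `∂/∂y` the derivative in the direction `Complex.I`. -/

namespace LdG

/-! ### The domain and its boundary curve -/

/-- The boundary of `Ω` is of class `C³`: near each of its points, `Ω` is the sublevel set of a
`C³` function with non-vanishing gradient. -/
def HasC3Boundary (Ω : Set ℂ) : Prop :=
  ∀ a ∈ frontier Ω, ∃ U : Set ℂ, IsOpen U ∧ a ∈ U ∧ ∃ h : ℂ → ℝ,
    ContDiff ℝ 3 h ∧ (∀ z ∈ U, fderiv ℝ h z ≠ 0) ∧ Ω ∩ U = {z ∈ U | h z < 0}

/-- A simply connected bounded domain in the plane with `C³` boundary. -/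
structure IsC3Domain (Ω : Set ℂ) : Prop where
  isOpen : IsOpen Ω
  isBounded : Bornology.IsBounded Ω
  simplyConnected : SimplyConnectedSpace Ω
  boundary : HasC3Boundary Ω

/-- The winding number about `z` of a curve `γ` parametrized over `[0,1]`. -/
def windingNumber (γ : ℝ → ℂ) (z : ℂ) : ℂ :=
  (1 / (2 * Real.pi * Complex.I)) * ∫ t in (0 : ℝ)..1, deriv γ t / (γ t - z)

/-- `γ : [0,1] → ∂Ω` is a `C³` positively oriented parametrization of `∂Ω`, one-to-one on
`[0,1)`. Positively oriented means, as usual, that `γ` winds once counterclockwise about the points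
of `Ω` and does not wind about the points outside the closure of `Ω`. -/
structure IsBoundaryParam (Ω : Set ℂ) (γ : ℝ → ℂ) : Prop where
  contDiff : ContDiffOn ℝ 3 γ (Icc 0 1)
  closed : γ 0 = γ 1
  injOn : InjOn γ (Ico 0 1)
  image : γ '' Icc 0 1 = frontier Ω
  winding_inside : ∀ z ∈ Ω, windingNumber γ z = 1
  winding_outside : ∀ z ∉ closure Ω, windingNumber γ z = 0

/-! ### Sobolev spaces -/

/-- Test functions: smooth, with compact support contained in `Ω`. -/
def IsTest (Ω : Set ℂ) (φ : ℂ → ℝ) : Prop :=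
  ContDiff ℝ ∞ φ ∧ HasCompactSupport φ ∧ tsupport φ ⊆ Ω

/-- `v` is a weak derivative of `u` in `Ω` in the direction `e`. -/
def IsWeakDeriv (Ω : Set ℂ) (e : ℂ) (u v : ℂ → ℝ) : Prop :=
  ∀ φ : ℂ → ℝ, IsTest Ω φ →
    ∫ z in Ω, u z * fderiv ℝ φ z e = - ∫ z in Ω, v z * φ z

/-- `u` has a weak derivative in the direction `e` that belongs to `L²(Ω)`. -/
def HasL2WeakDeriv (Ω : Set ℂ) (e : ℂ) (u : ℂ → ℝ) : Prop :=
  ∃ v : ℂ → ℝ, MemLp v 2 (volume.restrict Ω) ∧ IsWeakDeriv Ω e u v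

/-- `u ∈ W^{1,2}(Ω)`. -/
structure MemW12 (Ω : Set ℂ) (u : ℂ → ℝ) : Prop where
  memLp : MemLp u 2 (volume.restrict Ω)
  dx : HasL2WeakDeriv Ω 1 u
  dy : HasL2WeakDeriv Ω Complex.I u

open Classical in
/-- The weak derivative of `u` in the direction `e` (unique almost everywhere in `Ω`). -/
def weakDeriv (Ω : Set ℂ) (e : ℂ) (u : ℂ → ℝ) : ℂ → ℝ :=
  if h : HasL2WeakDeriv Ω e u then h.choose else 0

/-- `u_x`. -/
def Dx (Ω : Set ℂ) (u : ℂ → ℝ) : ℂ → ℝ := weakDeriv Ω 1 u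

/-- `u_y`. -/
def Dy (Ω : Set ℂ) (u : ℂ → ℝ) : ℂ → ℝ := weakDeriv Ω Complex.I u

/-- `u ∈ W₀^{1,2}(Ω)`, the closure of the test functions in `W^{1,2}(Ω)`. -/
def MemW12Zero (Ω : Set ℂ) (u : ℂ → ℝ) : Prop :=
  MemW12 Ω u ∧ ∀ δ : ℝ, 0 < δ → ∃ φ : ℂ → ℝ, IsTest Ω φ ∧
    eLpNorm (fun z => u z - φ z) 2 (volume.restrict Ω) ≤ ENNReal.ofReal δ ∧
    eLpNorm (fun z => Dx Ω u z - fderiv ℝ φ z 1) 2 (volume.restrict Ω) ≤ ENNReal.ofReal δ ∧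
    eLpNorm (fun z => Dy Ω u z - fderiv ℝ φ z Complex.I) 2 (volume.restrict Ω)
      ≤ ENNReal.ofReal δ

/-- `u ∈ W^{1,2}(Ω)` and `u = g` on `∂Ω` in the Sobolev sense: `u - U ∈ W₀^{1,2}(Ω)` for a `C¹`
function `U` on the plane that agrees with `g` on `∂Ω`. -/
def EqOnBoundary (Ω : Set ℂ) (u g : ℂ → ℝ) : Prop :=
  MemW12 Ω u ∧ ∃ U : ℂ → ℝ, ContDiff ℝ 1 U ∧ EqOn U g (frontier Ω) ∧
    MemW12Zero Ω (fun z => u z - U z)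

/-! ### Q-tensors -/

/-- `3 × 3` real matrices. -/
abbrev Mat3 := Matrix (Fin 3) (Fin 3) ℝ

/-- `𝒮`: the symmetric traceless matrices. -/
def IsQTensor (Q : Mat3) : Prop := Q.IsSymm ∧ Q.trace = 0

/-- `s (m ⊗ m - I/3)`. -/
def uniaxial (s : ℝ) (m : Fin 3 → ℝ) : Mat3 :=
  s • (Matrix.vecMulVec m m - (1 / 3 : ℝ) • (1 : Mat3))

/-- `Q(p, r)`. -/
def Qpr (p₁ p₂ r : ℝ) : Mat3 :=
  !![p₁ + r / 2, p₂, 0; p₂, r / 2 - p₁, 0; 0, 0, -r]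

/-- The linear coordinates `z₁, …, z₅` of `𝒮`. -/
def coordMat (z : Fin 5 → ℝ) : Mat3 :=
  !![z 0, z 1, z 3; z 1, z 2, z 4; z 3, z 4, -z 0 - z 2]

/-! ### Boundary data -/

/-- The boundary datum `Q₀`: each entry is of class `C³` on `∂Ω` (the restriction to `∂Ω` of a `C³`
function on the plane), and `Q₀ = s (n₀ ⊗ n₀ - I/3)` for unit vectors `n₀ = ⟨n₁, n₂, 0⟩`. -/
structure IsBoundaryDatum (Ω : Set ℂ) (s : ℝ) (Q₀ : ℂ → Mat3) : Prop where
  smooth : ∀ i j, ∃ E : ℂ → ℝ, ContDiff ℝ 3 E ∧ EqOn E (fun z => Q₀ z i j) (frontier Ω)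
  form : ∀ z ∈ frontier Ω, ∃ n₁ n₂ : ℝ, n₁ ^ 2 + n₂ ^ 2 = 1 ∧ Q₀ z = uniaxial s ![n₁, n₂, 0]

/-- `deg Q₀ = d`: for a unit field `ñ = ⟨n₁, n₂, 0⟩` along `γ`, of class `C¹` on `[0,1)`, with
`Q₀ = s (ñ ⊗ ñ - I/3)`, one has `(1/2π) ∫₀¹ ñ^⊥ · ñ' dt = d`, where `ñ^⊥ = ⟨-n₂, n₁, 0⟩`. -/
def HasDegree (s : ℝ) (γ : ℝ → ℂ) (Q₀ : ℂ → Mat3) (d : ℝ) : Prop :=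
  ∃ n₁ n₂ : ℝ → ℝ, ContDiffOn ℝ 1 n₁ (Ico 0 1) ∧ ContDiffOn ℝ 1 n₂ (Ico 0 1) ∧
    (∀ t ∈ Ico (0 : ℝ) 1, n₁ t ^ 2 + n₂ t ^ 2 = 1 ∧ Q₀ (γ t) = uniaxial s ![n₁ t, n₂ t, 0]) ∧
    (1 / (2 * Real.pi)) * (∫ t in (0 : ℝ)..1, (-n₂ t * deriv n₁ t + n₁ t * deriv n₂ t)) = d

/-- The pairs `(p, r) ∈ A₀`; here `Q₀ = Q(p₀, s/3)` on `∂Ω`, that is,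
`p₀ = ((Q₀₁₁ - Q₀₂₂)/2, Q₀₁₂)`. -/
structure MemA0 (Ω : Set ℂ) (s : ℝ) (Q₀ : ℂ → Mat3) (p₁ p₂ r : ℂ → ℝ) : Prop where
  p₁_eq : EqOnBoundary Ω p₁ (fun z => (Q₀ z 0 0 - Q₀ z 1 1) / 2)
  p₂_eq : EqOnBoundary Ω p₂ (fun z => Q₀ z 0 1)
  r_eq : EqOnBoundary Ω r (fun _ => s / 3)

/-- `ℳ`: the fields `Q ∈ W^{1,2}(Ω; ℝ^{3×3})` with `Q = Q₀` on `∂Ω`. -/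
def MemM (Ω : Set ℂ) (Q₀ Q : ℂ → Mat3) : Prop :=
  ∀ i j, EqOnBoundary Ω (fun z => Q z i j) (fun z => Q₀ z i j)

/-! ### The bulk energy density -/

/-- The function `g_b` on `[0,∞) × ℝ` with `f_b(Q(p, r)) = g_b(|p|², r)`: by the rotation
invariance of `f_b` it can be read off at `p = (|p|, 0)`. -/
def gb (fb : Mat3 → ℝ) (t r : ℝ) : ℝ := fb (Qpr (Real.sqrt t) 0 r)

/-- The assumptions on the bulk energy density `f_b : 𝒮 → ℝ` (values off `𝒮` play no role):
smoothness, non-negativity, energy well `Λ_s`, frame indifference, and the structural conditions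
on `g_b`. -/
structure IsBulk (s : ℝ) (fb : Mat3 → ℝ) : Prop where
  smooth : ContDiff ℝ ∞ (fun z : Fin 5 → ℝ => fb (coordMat z))
  nonneg : ∀ Q, IsQTensor Q → 0 ≤ fb Q
  well : ∀ Q, IsQTensor Q →
    (fb Q = 0 ↔ ∃ m : Fin 3 → ℝ, m 0 ^ 2 + m 1 ^ 2 + m 2 ^ 2 = 1 ∧ Q = uniaxial s m)
  frame : ∀ Q, IsQTensor Q → ∀ R ∈ Matrix.orthogonalGroup (Fin 3) ℝ,
    fb (R * Q * R.transpose) = fb Q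
  gb_smooth : ContDiffOn ℝ ∞ (fun x : ℝ × ℝ => gb fb x.1 x.2) (Ici 0 ×ˢ univ)
  gb_nonneg : ∀ t r : ℝ, 0 ≤ t → 0 ≤ gb fb t r
  gb_zero : gb fb (s ^ 2 / 4) (s / 3) = 0
  gb_deriv : ∃ m₁ m₂ : ℝ, 0 < m₁ ∧ 0 < m₂ ∧ ∀ ρ r : ℝ, 0 ≤ ρ →
    |derivWithin (fun t => gb fb t r) (Ici 0) (ρ ^ 2)| * ρ + |deriv (fun r' => gb fb (ρ ^ 2) r') r|
      ≤ m₁ * (ρ ^ 3 + |r| ^ 3) + m₂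
  gb_lower : ∃ m₃ : ℝ, 0 < m₃ ∧ ∀ ρ r : ℝ, 0 ≤ ρ →
    m₃ * (ρ ^ 4 + |r| ^ 4) - 1 ≤ gb fb (ρ ^ 2) r
  gb_well : ∃ δ m₄ : ℝ, 0 < δ ∧ 0 < m₄ ∧ ∀ ρ r : ℝ, 0 ≤ ρ →
    |ρ - |s| / 2| + |r - s / 3| < δ →
      m₄ * ((ρ ^ 2 - s ^ 2 / 4) ^ 2 + |r - s / 3| ^ 2) ≤ gb fb (ρ ^ 2) r

/-! ### The energies -/

/-- `Q_{ij,k}` at a point; the derivative in the third direction vanishes. -/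
def grad (Ω : Set ℂ) (Q : ℂ → Mat3) (z : ℂ) (i j : Fin 3) : Fin 3 → ℝ :=
  ![Dx Ω (fun w => Q w i j) z, Dy Ω (fun w => Q w i j) z, 0]

/-- The elastic density `f_e`, as a function of `D i j k = Q_{ij,k}`. -/
def fe (L₁ L₂ L₃ : ℝ) (D : Fin 3 → Fin 3 → Fin 3 → ℝ) : ℝ :=
  L₁ / 2 * (∑ i, ∑ j, ∑ k, D i j k * D i j k)
    + L₂ / 2 * (∑ i, ∑ j, ∑ k, D i j j * D i k k)
    + L₃ / 2 * (∑ i, ∑ j, ∑ k, D i j k * D i k j)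

/-- `Q_{ij,k} Q_{ik,j} - Q_{ij,j} Q_{ik,k}`. -/
def nullDensity (D : Fin 3 → Fin 3 → Fin 3 → ℝ) : ℝ :=
  ∑ i, ∑ j, ∑ k, (D i j k * D i k j - D i j j * D i k k)

/-- The integrand of `F_ε`. -/
def fDensity (Ω : Set ℂ) (L₁ L₂ L₃ ε : ℝ) (fb : Mat3 → ℝ) (Q : ℂ → Mat3) (z : ℂ) : ℝ :=
  fe L₁ L₂ L₃ (grad Ω Q z) + 1 / ε ^ 2 * fb (Q z)

/-- `F_ε(Q)`. -/
def F (Ω : Set ℂ) (L₁ L₂ L₃ ε : ℝ) (fb : Mat3 → ℝ) (Q : ℂ → Mat3) : ℝ :=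
  ∫ z in Ω, fDensity Ω L₁ L₂ L₃ ε fb Q z

/-- The elastic density `g_e(∇p, ∇r)`. -/
def ge (L₁ L₂ L₃ p₁x p₁y p₂x p₂y rx ry : ℝ) : ℝ :=
  (L₁ + (L₂ + L₃) / 2) * (p₁x ^ 2 + p₁y ^ 2 + p₂x ^ 2 + p₂y ^ 2)
    + (3 * L₁ / 4 + (L₂ + L₃) / 8) * (rx ^ 2 + ry ^ 2)
    + (L₂ + L₃) / 2 * (p₁x * rx - p₁y * ry + rx * p₂y + ry * p₂x)
    + |L₂ + L₃| * (p₁x * p₂y - p₁y * p₂x)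

/-- The integrand of `G_ε`. -/
def gDensity (Ω : Set ℂ) (L₁ L₂ L₃ ε : ℝ) (fb : Mat3 → ℝ) (p₁ p₂ r : ℂ → ℝ) (z : ℂ) : ℝ :=
  ge L₁ L₂ L₃ (Dx Ω p₁ z) (Dy Ω p₁ z) (Dx Ω p₂ z) (Dy Ω p₂ z) (Dx Ω r z) (Dy Ω r z)
    + 1 / ε ^ 2 * gb fb (p₁ z ^ 2 + p₂ z ^ 2) (r z)

/-- `G_ε(p, r)`. -/
def G (Ω : Set ℂ) (L₁ L₂ L₃ ε : ℝ) (fb : Mat3 → ℝ) (p₁ p₂ r : ℂ → ℝ) : ℝ :=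
  ∫ z in Ω, gDensity Ω L₁ L₂ L₃ ε fb p₁ p₂ r z

/-- The Jacobian `p_{1x} p_{2y} - p_{1y} p_{2x}`. -/
def jac (Ω : Set ℂ) (p₁ p₂ : ℂ → ℝ) (z : ℂ) : ℝ :=
  Dx Ω p₁ z * Dy Ω p₂ z - Dy Ω p₁ z * Dx Ω p₂ z

/-- The density `N(∇Q)` is a null Lagrangian for the boundary datum `Q₀`: its integral over `Ω` is
(finite and) constant on `ℳ`, and its first variation vanishes at every element of `ℳ`. -/
structure IsNullLagrangian (Ω : Set ℂ) (Q₀ : ℂ → Mat3)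
    (N : (Fin 3 → Fin 3 → Fin 3 → ℝ) → ℝ) : Prop where
  integrable : ∀ Q, MemM Ω Q₀ Q → IntegrableOn (fun z => N (grad Ω Q z)) Ω
  const : ∀ Q Q', MemM Ω Q₀ Q → MemM Ω Q₀ Q' →
    ∫ z in Ω, N (grad Ω Q z) = ∫ z in Ω, N (grad Ω Q' z)
  firstVariation : ∀ Q V : ℂ → Mat3, MemM Ω Q₀ Q → (∀ i j, MemW12Zero Ω (fun z => V z i j)) →
    HasDerivAt (fun t : ℝ => ∫ z in Ω, N (grad Ω (fun w => Q w + t • V w) z)) 0 0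

end LdG

end

/-! Everything reduces to one number, the integral of the Jacobian of `p`. For `Q = Q(p, r)`,
algebra on the weak gradients gives, almost everywhere, `N(∇Q) = -4 jac p₁ p₂` and the pointwise
relation between the two energy densities. The bulk terms agree because a rotation about the third
axis takes `p` to `(|p|, 0)` (`IsBulk.fb_Qpr`).

Since nothing depends on the third variable, `N` is `-2` times a sum of Jacobians, one for each row
of `Q`. A Jacobian integrates to zero if one argument lies in `W₀^{1,2}` (`integral_jac_eq_zero`),
so its integral depends only on boundary values; this is why `N` is a null Lagrangian. Replacing the
fields by `C¹` extensions `U`, `V` of their boundary values, Green's formula turns the integral into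
`∮ U dV` (`IsBoundaryParam.integral_jac`). On `∂Ω`, `p = (s/2)(cos 2θ, sin 2θ)` where `n = (cos θ,
sin θ)`, so half of `∮ (p₁ dp₂ - p₂ dp₁)` is a multiple of the degree.

Green's formula comes from the winding number rather than from local charts: the Cauchy–Pompeiu
formula for a compactly supported function is integrated along `γ`, and Fubini produces the winding
number, which is the indicator of `Ω` almost everywhere.

Finiteness of the bulk term follows from quartic growth of `g_b` and the embedding of `W^{1,2}` into
`L⁴`, applied after subtracting the `C¹` extension. -/

namespace LdG

/-! ### Weak derivatives -/

section Weak

variable {Ω : Set ℂ} {e : ℂ} {u v u' v' : ℂ → ℝ}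

lemma IsTest.memLp {φ : ℂ → ℝ} (hφ : IsTest Ω φ) (μ : Measure ℂ) [IsFiniteMeasureOnCompacts μ] :
    MemLp φ 2 μ :=
  hφ.1.continuous.memLp_of_hasCompactSupport hφ.2.1

lemma IsTest.fderiv_apply {φ : ℂ → ℝ} (hφ : IsTest Ω φ) (e : ℂ) :
    IsTest Ω (fun z => fderiv ℝ φ z e) := by
  refine ⟨?_, hφ.2.1.fderiv_apply (𝕜 := ℝ) e, ?_⟩
  · have := hφ.1.fderiv_right (m := ∞) (by simp)
    exact this.clm_apply contDiff_const
  · exact (tsupport_fderiv_apply_subset ℝ e).trans hφ.2.2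

lemma IsTest.add_mul {φ ψ : ℂ → ℝ} (hφ : IsTest Ω φ) (hψ : IsTest Ω ψ) (a : ℝ) :
    IsTest Ω (fun z => φ z + a * ψ z) := by
  refine ⟨hφ.1.add (contDiff_const.mul hψ.1), hφ.2.1.add hψ.2.1.mul_left, ?_⟩
  have h1 : tsupport (fun z => a * ψ z) ⊆ tsupport ψ :=
    tsupport_mul_subset_right (f := fun _ => a) (g := ψ)
  exact (tsupport_add φ _).trans (union_subset hφ.2.2 (h1.trans hψ.2.2))

/-- The difference is orthogonal to all test functions, so the fundamental lemma of the calculus of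
variations applies. As `weakDeriv` is an arbitrary choice, every computation with it passes through
this uniqueness and holds only almost everywhere. -/
lemma IsWeakDeriv.ae_eq (hΩ : IsOpen Ω) (hv : MemLp v 2 (volume.restrict Ω))
    (hv' : MemLp v' 2 (volume.restrict Ω)) (h : IsWeakDeriv Ω e u v) (h' : IsWeakDeriv Ω e u v') :
    v =ᵐ[volume.restrict Ω] v' := by
  have key : ∀ᵐ z ∂(volume : Measure ℂ), z ∈ Ω → (v - v') z = 0 := by
    refine hΩ.ae_eq_zero_of_integral_contDiff_smul_eq_zero ?_ ?_
    · have h1 : LocallyIntegrable (v - v') (volume.restrict Ω) :=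
        (hv.sub hv').locallyIntegrable (by norm_num)
      exact locallyIntegrableOn_of_locallyIntegrable_restrict h1
    · intro g hg hgc hgs
      have ht : IsTest Ω g := ⟨hg, hgc, hgs⟩
      have hz : ∀ z, z ∉ Ω → g z • (v - v') z = 0 := fun z hz => by
        rw [image_eq_zero_of_notMem_tsupport fun hh => hz (hgs hh), zero_smul]
      rw [← setIntegral_eq_integral_of_forall_compl_eq_zero hz]
      have hgL := ht.memLp (volume.restrict Ω)
      have e1 := h g ht
      have e2 := h' g ht
      have i1 : Integrable (fun z => v z * g z) (volume.restrict Ω) := hv.integrable_mul hgL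
      have i2 : Integrable (fun z => v' z * g z) (volume.restrict Ω) := hv'.integrable_mul hgL
      have : ∫ z in Ω, g z • (v - v') z = (∫ z in Ω, v z * g z) - ∫ z in Ω, v' z * g z := by
        rw [← integral_sub i1 i2]
        congr 1; ext z; simp; ring
      rw [this]; linarith
  rw [Filter.EventuallyEq, ae_restrict_iff' hΩ.measurableSet]
  filter_upwards [key] with z hz hzΩ
  exact sub_eq_zero.1 (hz hzΩ)

lemma HasL2WeakDeriv.memLp (h : HasL2WeakDeriv Ω e u) :
    MemLp (weakDeriv Ω e u) 2 (volume.restrict Ω) := by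
  rw [weakDeriv, dif_pos h]; exact h.choose_spec.1

lemma HasL2WeakDeriv.isWeakDeriv (h : HasL2WeakDeriv Ω e u) :
    IsWeakDeriv Ω e u (weakDeriv Ω e u) := by
  rw [weakDeriv, dif_pos h]; exact h.choose_spec.2

lemma IsWeakDeriv.weakDeriv_ae_eq (hΩ : IsOpen Ω) (hv : MemLp v 2 (volume.restrict Ω))
    (h : IsWeakDeriv Ω e u v) : weakDeriv Ω e u =ᵐ[volume.restrict Ω] v := by
  have hh : HasL2WeakDeriv Ω e u := ⟨v, hv, h⟩
  exact hh.isWeakDeriv.ae_eq hΩ hh.memLp hv h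

lemma IsWeakDeriv.linear (hu : MemLp u 2 (volume.restrict Ω)) (hv : MemLp v 2 (volume.restrict Ω))
    (hu' : MemLp u' 2 (volume.restrict Ω)) (hv' : MemLp v' 2 (volume.restrict Ω))
    (h : IsWeakDeriv Ω e u u') (h' : IsWeakDeriv Ω e v v') (a b : ℝ) :
    IsWeakDeriv Ω e (fun z => a * u z + b * v z) (fun z => a * u' z + b * v' z) := by
  intro φ hφ
  have hL := hφ.memLp (volume.restrict Ω)
  have hL' := (hφ.fderiv_apply e).memLp (volume.restrict Ω)
  have i1 : Integrable (fun z => u z * fderiv ℝ φ z e) (volume.restrict Ω) := hu.integrable_mul hL'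
  have i2 : Integrable (fun z => v z * fderiv ℝ φ z e) (volume.restrict Ω) := hv.integrable_mul hL'
  have i3 : Integrable (fun z => u' z * φ z) (volume.restrict Ω) := hu'.integrable_mul hL
  have i4 : Integrable (fun z => v' z * φ z) (volume.restrict Ω) := hv'.integrable_mul hL
  simp only [add_mul, mul_assoc]
  rw [integral_add (i1.const_mul a) (i2.const_mul b), integral_add (i3.const_mul a) (i4.const_mul b)]
  simp only [integral_const_mul]
  rw [h φ hφ, h' φ hφ]; ring

lemma HasL2WeakDeriv.linear (hu : MemLp u 2 (volume.restrict Ω))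
    (hv : MemLp v 2 (volume.restrict Ω)) (h : HasL2WeakDeriv Ω e u) (h' : HasL2WeakDeriv Ω e v)
    (a b : ℝ) : HasL2WeakDeriv Ω e (fun z => a * u z + b * v z) :=
  ⟨_, (h.memLp.const_mul a).add (h'.memLp.const_mul b),
    h.isWeakDeriv.linear hu hv h.memLp h'.memLp h'.isWeakDeriv a b⟩

lemma weakDeriv_linear (hΩ : IsOpen Ω) (hu : MemLp u 2 (volume.restrict Ω))
    (hv : MemLp v 2 (volume.restrict Ω)) (h : HasL2WeakDeriv Ω e u) (h' : HasL2WeakDeriv Ω e v)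
    (a b : ℝ) : weakDeriv Ω e (fun z => a * u z + b * v z) =ᵐ[volume.restrict Ω]
      fun z => a * weakDeriv Ω e u z + b * weakDeriv Ω e v z :=
  (h.isWeakDeriv.linear hu hv h.memLp h'.memLp h'.isWeakDeriv a b).weakDeriv_ae_eq hΩ
    ((h.memLp.const_mul a).add (h'.memLp.const_mul b))

lemma MemW12.linear (hu : MemW12 Ω u) (hv : MemW12 Ω v) (a b : ℝ) :
    MemW12 Ω (fun z => a * u z + b * v z) :=
  ⟨(hu.memLp.const_mul a).add (hv.memLp.const_mul b), hu.dx.linear hu.memLp hv.memLp hv.dx a b,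
    hu.dy.linear hu.memLp hv.memLp hv.dy a b⟩

lemma MemW12.Dx_linear (hΩ : IsOpen Ω) (hu : MemW12 Ω u) (hv : MemW12 Ω v) (a b : ℝ) :
    Dx Ω (fun z => a * u z + b * v z) =ᵐ[volume.restrict Ω]
      fun z => a * Dx Ω u z + b * Dx Ω v z :=
  weakDeriv_linear hΩ hu.memLp hv.memLp hu.dx hv.dx a b

lemma MemW12.Dy_linear (hΩ : IsOpen Ω) (hu : MemW12 Ω u) (hv : MemW12 Ω v) (a b : ℝ) :
    Dy Ω (fun z => a * u z + b * v z) =ᵐ[volume.restrict Ω]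
      fun z => a * Dy Ω u z + b * Dy Ω v z :=
  weakDeriv_linear hΩ hu.memLp hv.memLp hu.dy hv.dy a b

lemma MemW12.memLp_Dx (hu : MemW12 Ω u) : MemLp (Dx Ω u) 2 (volume.restrict Ω) := hu.dx.memLp

lemma MemW12.memLp_Dy (hu : MemW12 Ω u) : MemLp (Dy Ω u) 2 (volume.restrict Ω) := hu.dy.memLp

/-! ### Functions of class `C¹` -/

lemma memLp_restrict_of_continuous (hb : Bornology.IsBounded Ω) (hu : Continuous u)
    (p : ENNReal) : MemLp u p (volume.restrict Ω) := by
  have : IsFiniteMeasure (volume.restrict Ω) := ⟨by simpa using hb.measure_lt_top⟩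
  obtain ⟨C, hC⟩ := hb.isCompact_closure.exists_bound_of_continuousOn hu.continuousOn
  refine MemLp.of_bound hu.aestronglyMeasurable C ?_
  have : ∀ᵐ z ∂(volume.restrict (closure Ω)), ‖u z‖ ≤ C :=
    (ae_restrict_iff' isClosed_closure.measurableSet).2 (ae_of_all _ hC)
  exact ae_restrict_of_ae_restrict_of_subset subset_closure this

/-- The test function has compact support in `Ω`, so both integrals extend to the whole plane and
integration by parts leaves no boundary term. -/
lemma isWeakDeriv_of_contDiff (hu : ContDiff ℝ 1 u) (e : ℂ) :
    IsWeakDeriv Ω e u (fun z => fderiv ℝ u z e) := by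
  intro φ hφ
  have hφ' := hφ.fderiv_apply e
  have hd : Continuous (fun z => fderiv ℝ u z e) :=
    (hu.continuous_fderiv (by simp)).clm_apply continuous_const
  have z1 : ∀ z, z ∉ Ω → u z * fderiv ℝ φ z e = 0 := fun z hz => by
    rw [image_eq_zero_of_notMem_tsupport (f := fun z => fderiv ℝ φ z e) fun hh => hz (hφ'.2.2 hh),
      mul_zero]
  have z2 : ∀ z, z ∉ Ω → fderiv ℝ u z e * φ z = 0 := fun z hz => by
    rw [image_eq_zero_of_notMem_tsupport fun hh => hz (hφ.2.2 hh), mul_zero]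
  rw [setIntegral_eq_integral_of_forall_compl_eq_zero z1,
    setIntegral_eq_integral_of_forall_compl_eq_zero z2]
  refine integral_mul_fderiv_eq_neg_fderiv_mul_of_integrable ?_ ?_ ?_ ?_ ?_
  · exact (hd.mul hφ.1.continuous).integrable_of_hasCompactSupport hφ.2.1.mul_left
  · exact (hu.continuous.mul hφ'.1.continuous).integrable_of_hasCompactSupport hφ'.2.1.mul_left
  · exact (hu.continuous.mul hφ.1.continuous).integrable_of_hasCompactSupport hφ.2.1.mul_left
  · exact fun x _ => hu.differentiable (by simp) x
  · exact fun x _ => hφ.1.differentiable (by simp) x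

lemma weakDeriv_of_contDiff (hΩ : IsOpen Ω) (hb : Bornology.IsBounded Ω) (hu : ContDiff ℝ 1 u)
    (e : ℂ) : HasL2WeakDeriv Ω e u ∧
      weakDeriv Ω e u =ᵐ[volume.restrict Ω] fun z => fderiv ℝ u z e := by
  have hd : Continuous (fun z => fderiv ℝ u z e) :=
    (hu.continuous_fderiv (by simp)).clm_apply continuous_const
  have h := memLp_restrict_of_continuous hb hd 2
  exact ⟨⟨_, h, isWeakDeriv_of_contDiff hu e⟩,
    (isWeakDeriv_of_contDiff hu e).weakDeriv_ae_eq hΩ h⟩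

lemma memW12_of_contDiff (hΩ : IsOpen Ω) (hb : Bornology.IsBounded Ω) (hu : ContDiff ℝ 1 u) :
    MemW12 Ω u :=
  ⟨memLp_restrict_of_continuous hb hu.continuous 2, (weakDeriv_of_contDiff hΩ hb hu 1).1,
    (weakDeriv_of_contDiff hΩ hb hu Complex.I).1⟩

/-! ### Functions vanishing on the boundary -/

lemma eLpNorm_add_mul_le {f g : ℂ → ℝ} {μ : Measure ℂ} (hf : AEStronglyMeasurable f μ)
    (hg : AEStronglyMeasurable g μ) {a δ δ' : ℝ} (hδ : 0 ≤ δ) (hδ' : 0 ≤ δ')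
    (h1 : eLpNorm f 2 μ ≤ ENNReal.ofReal δ) (h2 : eLpNorm g 2 μ ≤ ENNReal.ofReal δ') :
    eLpNorm (fun z => f z + a * g z) 2 μ ≤ ENNReal.ofReal (δ + |a| * δ') := by
  have h3 : eLpNorm (fun z => a * g z) 2 μ ≤ ENNReal.ofReal (|a| * δ') := by
    have : (fun z => a * g z) = a • g := rfl
    rw [this, eLpNorm_const_smul, ENNReal.ofReal_mul (abs_nonneg a)]
    gcongr
    rw [← Real.norm_eq_abs, ofReal_norm]
  calc _ ≤ eLpNorm f 2 μ + eLpNorm (fun z => a * g z) 2 μ :=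
        eLpNorm_add_le hf (hg.const_mul a) (by norm_num)
    _ ≤ ENNReal.ofReal δ + ENNReal.ofReal (|a| * δ') := add_le_add h1 h3
    _ = _ := (ENNReal.ofReal_add hδ (by positivity)).symm

lemma MemW12Zero.add_mul (hΩ : IsOpen Ω) (hu : MemW12Zero Ω u) (hv : MemW12Zero Ω v) (a : ℝ) :
    MemW12Zero Ω (fun z => u z + a * v z) := by
  have hlin := hu.1.linear hv.1 1 a
  have hx := hu.1.Dx_linear hΩ hv.1 1 a
  have hy := hu.1.Dy_linear hΩ hv.1 1 a
  simp only [one_mul] at hlin hx hy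
  refine ⟨hlin, fun δ hδ => ?_⟩
  obtain ⟨φ, hφ, f1, f2, f3⟩ := hu.2 (δ / 2) (by positivity)
  -- The tolerance is divided by `|a| + 1` so that multiplication by `a` costs at most `δ / 2`,
  -- including when `a = 0`.
  obtain ⟨ψ, hψ, g1, g2, g3⟩ := hv.2 (δ / 2 / (|a| + 1)) (by positivity)
  have hle : ENNReal.ofReal (δ / 2 + |a| * (δ / 2 / (|a| + 1))) ≤ ENNReal.ofReal δ := by
    apply ENNReal.ofReal_le_ofReal
    have : |a| * (δ / 2 / (|a| + 1)) ≤ δ / 2 := by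
      rw [← mul_div_assoc, div_le_iff₀ (by positivity)]
      nlinarith [abs_nonneg a]
    linarith
  have hfd : ∀ z e, fderiv ℝ (fun z => φ z + a * ψ z) z e = fderiv ℝ φ z e + a * fderiv ℝ ψ z e := by
    intro z e
    have d1 := hφ.1.differentiable (by simp) z
    have d2 := hψ.1.differentiable (by simp) z
    rw [fderiv_fun_add d1 (d2.const_mul a), fderiv_const_mul d2]
    simp
  refine ⟨_, hφ.add_mul hψ a, ?_, ?_, ?_⟩
  · refine le_trans (le_of_eq ?_) ((eLpNorm_add_mul_le (a := a) ?_ ?_ (by positivity) (by positivity)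
      f1 g1).trans hle)
    · congr 1; ext z; ring
    · exact (hu.1.memLp.sub (hφ.memLp _)).1
    · exact (hv.1.memLp.sub (hψ.memLp _)).1
  · refine le_trans (le_of_eq ?_) ((eLpNorm_add_mul_le (a := a) ?_ ?_ (by positivity) (by positivity)
      f2 g2).trans hle)
    · refine eLpNorm_congr_ae ?_
      filter_upwards [hx] with z hz
      rw [hz, hfd]; ring
    · exact (hu.1.memLp_Dx.sub ((hφ.fderiv_apply 1).memLp _)).1
    · exact (hv.1.memLp_Dx.sub ((hψ.fderiv_apply 1).memLp _)).1
  · refine le_trans (le_of_eq ?_) ((eLpNorm_add_mul_le (a := a) ?_ ?_ (by positivity) (by positivity)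
      f3 g3).trans hle)
    · refine eLpNorm_congr_ae ?_
      filter_upwards [hy] with z hz
      rw [hz, hfd]; ring
    · exact (hu.1.memLp_Dy.sub ((hφ.fderiv_apply _).memLp _)).1
    · exact (hv.1.memLp_Dy.sub ((hψ.fderiv_apply _).memLp _)).1

/-! ### The Jacobian -/

lemma MemW12.integrable_jac (hu : MemW12 Ω u) (hv : MemW12 Ω v) : IntegrableOn (jac Ω u v) Ω :=
  (hu.memLp_Dx.integrable_mul hv.memLp_Dy).sub (hu.memLp_Dy.integrable_mul hv.memLp_Dx)

/-- Cauchy–Schwarz, in the form that accepts the approximation bounds of `MemW12Zero`. -/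
lemma abs_integral_mul_le {f g : ℂ → ℝ} {μ : Measure ℂ} (hf : AEStronglyMeasurable f μ)
    (hg : MemLp g 2 μ) {δ : ℝ} (hδ : 0 ≤ δ) (h : eLpNorm f 2 μ ≤ ENNReal.ofReal δ) :
    |∫ z, f z * g z ∂μ| ≤ δ * (eLpNorm g 2 μ).toReal := by
  have h1 : eLpNorm (f • g) 1 μ ≤ eLpNorm f 2 μ * eLpNorm g 2 μ :=
    eLpNorm_smul_le_mul_eLpNorm hg.1 hf
  have h2 : ‖∫ z, f z * g z ∂μ‖ₑ ≤ ENNReal.ofReal δ * eLpNorm g 2 μ := by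
    refine (enorm_integral_le_lintegral_enorm _).trans ?_
    rw [eLpNorm_one_eq_lintegral_enorm] at h1
    exact h1.trans (by gcongr)
  rw [← Real.norm_eq_abs, ← toReal_enorm]
  have := ENNReal.toReal_mono (ENNReal.mul_ne_top ENNReal.ofReal_ne_top hg.2.ne) h2
  rwa [ENNReal.toReal_mul, ENNReal.toReal_ofReal hδ] at this

/-- Testing the weak derivatives of `v` against `φ_x` and `φ_y` gives `-∫ v φ_xy` both times, by
symmetry of second derivatives. Thus no second derivative of `v` is needed. -/
lemma integral_jac_test {φ : ℂ → ℝ} (hφ : IsTest Ω φ) (hv : MemW12 Ω v) :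
    (∫ z in Ω, fderiv ℝ φ z 1 * Dy Ω v z) - ∫ z in Ω, fderiv ℝ φ z Complex.I * Dx Ω v z = 0 := by
  have h1 := hv.dy.isWeakDeriv _ (hφ.fderiv_apply 1)
  have h2 := hv.dx.isWeakDeriv _ (hφ.fderiv_apply Complex.I)
  have hsymm : ∀ z, fderiv ℝ (fun w => fderiv ℝ φ w 1) z Complex.I
      = fderiv ℝ (fun w => fderiv ℝ φ w Complex.I) z 1 := by
    intro z
    have hd : DifferentiableAt ℝ (fderiv ℝ φ) z :=
      (hφ.1.fderiv_right (m := ∞) (by simp)).differentiable (by simp) z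
    have hs : IsSymmSndFDerivAt ℝ φ z :=
      (hφ.1.contDiffAt).isSymmSndFDerivAt (by simpa using WithTop.coe_le_coe.2 (le_top : (2 : ℕ∞) ≤ ⊤))
    have := hs Complex.I 1
    rw [fderiv_clm_apply hd (differentiableAt_const _), fderiv_clm_apply hd (differentiableAt_const _)]
    simpa using this
  simp only [hsymm] at h1
  rw [h1] at h2
  have c1 : ∀ z, fderiv ℝ φ z 1 * Dy Ω v z = weakDeriv Ω Complex.I v z * fderiv ℝ φ z 1 :=
    fun z => mul_comm _ _
  have c2 : ∀ z, fderiv ℝ φ z Complex.I * Dx Ω v z = weakDeriv Ω 1 v z * fderiv ℝ φ z Complex.I :=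
    fun z => mul_comm _ _
  simp only [c1, c2]
  linarith

/-- With a test function in place of `u` the integral vanishes; the error is linear in `∇(u - φ)`
and is controlled by Cauchy–Schwarz. -/
lemma integral_jac_eq_zero (hu : MemW12Zero Ω u) (hv : MemW12 Ω v) :
    ∫ z in Ω, jac Ω u v z = 0 := by
  set A := (eLpNorm (Dy Ω v) 2 (volume.restrict Ω)).toReal
  set B := (eLpNorm (Dx Ω v) 2 (volume.restrict Ω)).toReal
  have hA : 0 ≤ A := ENNReal.toReal_nonneg
  have hB : 0 ≤ B := ENNReal.toReal_nonneg
  have key : ∀ δ : ℝ, 0 < δ → |∫ z in Ω, jac Ω u v z| ≤ δ * (A + B) := by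
    intro δ hδ
    obtain ⟨φ, hφ, -, f2, f3⟩ := hu.2 δ hδ
    have m2 := (hφ.fderiv_apply 1).memLp (volume.restrict Ω)
    have m3 := (hφ.fderiv_apply Complex.I).memLp (volume.restrict Ω)
    have i1 : Integrable (fun z => (Dx Ω u z - fderiv ℝ φ z 1) * Dy Ω v z) (volume.restrict Ω) :=
      (hu.1.memLp_Dx.sub m2).integrable_mul hv.memLp_Dy
    have i2 : Integrable (fun z => (Dy Ω u z - fderiv ℝ φ z Complex.I) * Dx Ω v z)
        (volume.restrict Ω) := (hu.1.memLp_Dy.sub m3).integrable_mul hv.memLp_Dx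
    have i3 : Integrable (fun z => fderiv ℝ φ z 1 * Dy Ω v z) (volume.restrict Ω) :=
      m2.integrable_mul hv.memLp_Dy
    have i4 : Integrable (fun z => fderiv ℝ φ z Complex.I * Dx Ω v z) (volume.restrict Ω) :=
      m3.integrable_mul hv.memLp_Dx
    have e : ∫ z in Ω, jac Ω u v z = ((∫ z in Ω, (Dx Ω u z - fderiv ℝ φ z 1) * Dy Ω v z)
        - ∫ z in Ω, (Dy Ω u z - fderiv ℝ φ z Complex.I) * Dx Ω v z)
        + ((∫ z in Ω, fderiv ℝ φ z 1 * Dy Ω v z)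
        - ∫ z in Ω, fderiv ℝ φ z Complex.I * Dx Ω v z) := by
      rw [← integral_sub i1 i2, ← integral_sub i3 i4]
      refine Eq.trans ?_ (integral_add (i1.sub i2) (i3.sub i4))
      congr 1; ext z; simp only [jac]; ring
    rw [e, integral_jac_test hφ hv, add_zero]
    have b1 := abs_integral_mul_le (hu.1.memLp_Dx.sub m2).1 hv.memLp_Dy hδ.le f2
    have b2 := abs_integral_mul_le (hu.1.memLp_Dy.sub m3).1 hv.memLp_Dx hδ.le f3
    refine (abs_sub _ _).trans ?_
    rw [mul_add]
    exact add_le_add b1 b2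
  by_contra hne
  have hpos := abs_pos.2 hne
  -- This `δ` makes the bound at most half of the supposedly positive left-hand side.
  have := key (|∫ z in Ω, jac Ω u v z| / (2 * (A + B + 1))) (by positivity)
  rw [div_mul_eq_mul_div, le_div_iff₀ (by positivity)] at this
  nlinarith

lemma jac_swap (z : ℂ) : jac Ω u v z = - jac Ω v u z := by simp only [jac]; ring

/-- The integral of the Jacobian depends only on the boundary values. -/
lemma integral_jac_eq_of_sub_memW12Zero (hΩ : IsOpen Ω) (hb : Bornology.IsBounded Ω)
    {U V : ℂ → ℝ} (hU : ContDiff ℝ 1 U) (hV : ContDiff ℝ 1 V) (hu : MemW12 Ω u) (hv : MemW12 Ω v)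
    (huU : MemW12Zero Ω (fun z => u z - U z)) (hvV : MemW12Zero Ω (fun z => v z - V z)) :
    ∫ z in Ω, jac Ω u v z =
      ∫ z in Ω, (fderiv ℝ U z 1 * fderiv ℝ V z Complex.I
        - fderiv ℝ U z Complex.I * fderiv ℝ V z 1) := by
  have wU := memW12_of_contDiff hΩ hb hU
  have wV := memW12_of_contDiff hΩ hb hV
  have h1 := integral_jac_eq_zero huU hv
  have h2 := integral_jac_eq_zero hvV wU
  have x1 := hu.Dx_linear hΩ wU 1 (-1)
  have y1 := hu.Dy_linear hΩ wU 1 (-1)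
  have x2 := hv.Dx_linear hΩ wV 1 (-1)
  have y2 := hv.Dy_linear hΩ wV 1 (-1)
  simp only [one_mul, neg_mul, ← sub_eq_add_neg] at x1 y1 x2 y2
  -- Telescoping by bilinearity; antisymmetry puts the function with zero boundary values in the
  -- first slot both times.
  have e1 : jac Ω u v =ᵐ[volume.restrict Ω] fun z => jac Ω (fun z => u z - U z) v z
      - jac Ω (fun z => v z - V z) U z + jac Ω U V z := by
    filter_upwards [x1, y1, x2, y2] with z a1 a2 a3 a4
    simp only [jac, a1, a2, a3, a4]; ring
  rw [integral_congr_ae e1]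
  refine (integral_add ((huU.1.integrable_jac hv).sub (hvV.1.integrable_jac wU))
    (wU.integrable_jac wV)).trans ?_
  rw [integral_sub' (huU.1.integrable_jac hv) (hvV.1.integrable_jac wU), h1, h2, sub_zero, zero_add]
  refine integral_congr_ae ?_
  filter_upwards [(weakDeriv_of_contDiff hΩ hb hU 1).2, (weakDeriv_of_contDiff hΩ hb hV 1).2,
    (weakDeriv_of_contDiff hΩ hb hU Complex.I).2, (weakDeriv_of_contDiff hΩ hb hV Complex.I).2]
    with z a1 a2 a3 a4
  simp only [jac, Dx, Dy, a1, a2, a3, a4]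

end Weak

/-! ### The Cauchy–Pompeiu formula -/

section Pompeiu

lemma integrableOn_polar_target {A : ℝ × ℝ → ℂ} (hA : Continuous A) {R : ℝ}
    (hR : ∀ p : ℝ × ℝ, R < p.1 → A p = 0) :
    IntegrableOn A (Ioi (0 : ℝ) ×ˢ Ioo (-Real.pi) Real.pi) := by
  have h1 : IntegrableOn A (Icc (0 : ℝ) R ×ˢ Icc (-Real.pi) Real.pi) :=
    hA.continuousOn.integrableOn_compact (isCompact_Icc.prod isCompact_Icc)
  refine h1.of_forall_sdiff_eq_zero (measurableSet_Ioi.prod measurableSet_Ioo) ?_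
  rintro ⟨r, θ⟩ ⟨⟨h2, h3⟩, h4⟩
  refine hR _ ?_
  by_contra h5
  exact h4 ⟨⟨le_of_lt h2, not_lt.1 h5⟩, ⟨h3.1.le, h3.2.le⟩⟩

/-- The unit vector in the direction `θ`. -/
noncomputable def unitDir (θ : ℝ) : ℂ := Real.cos θ + Real.sin θ * Complex.I

lemma continuous_unitDir : Continuous unitDir := by unfold unitDir; fun_prop

lemma norm_unitDir (θ : ℝ) : ‖unitDir θ‖ = 1 := by
  have : unitDir θ = Complex.exp (θ * Complex.I) := by
    rw [Complex.exp_mul_I]; simp [unitDir]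
  rw [this, Complex.norm_exp_ofReal_mul_I]

lemma hasDerivAt_unitDir (θ : ℝ) : HasDerivAt unitDir (Complex.I * unitDir θ) θ := by
  have h1 := (Real.hasDerivAt_cos θ).ofReal_comp
  have h2 := ((Real.hasDerivAt_sin θ).ofReal_comp).mul_const Complex.I
  refine (h1.add h2).congr_deriv ?_
  simp only [unitDir, mul_add, Complex.ofReal_neg]
  linear_combination (-(Real.sin θ : ℂ)) * Complex.I_mul_I

variable {F : ℂ → ℂ}

/-- The fundamental theorem of calculus along a ray, where `F` vanishes far out. -/
lemma integral_radial_deriv (hF : ContDiff ℝ 1 F) (hc : HasCompactSupport F) (θ : ℝ) :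
    ∫ r in Ioi (0 : ℝ), fderiv ℝ F (r * unitDir θ) (unitDir θ) = - F 0 := by
  have hg : ContDiff ℝ 1 (fun r : ℝ => F (r * unitDir θ)) :=
    hF.comp ((Complex.ofRealCLM.contDiff).mul contDiff_const)
  obtain ⟨R, hR⟩ := hc.isCompact.isBounded.subset_closedBall 0
  have hgc : HasCompactSupport (fun r : ℝ => F (r * unitDir θ)) := by
    refine HasCompactSupport.intro (isCompact_closedBall (0 : ℝ) R) fun r hr => ?_
    refine image_eq_zero_of_notMem_tsupport fun h => hr ?_
    have := hR h
    simpa [norm_unitDir] using this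
  have h := hgc.integral_Ioi_deriv_eq hg 0
  simp only [Complex.ofReal_zero, zero_mul] at h
  rw [← h]
  congr 1; ext r
  have h1 : HasDerivAt (fun r : ℝ => (r : ℂ) * unitDir θ) (unitDir θ) r := by
    simpa using (Complex.ofRealCLM.hasDerivAt (x := r)).mul_const (unitDir θ)
  exact (((hF.differentiable (by simp) _).hasFDerivAt).comp_hasDerivAt r h1).deriv.symm

/-- Up to the factor `r`, the integrand is the derivative of a `2π`-periodic function of `θ`. -/
lemma integral_angular_deriv (hF : ContDiff ℝ 1 F) {r : ℝ} (hr : 0 < r) :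
    ∫ θ in Ioo (-Real.pi) Real.pi, fderiv ℝ F (r * unitDir θ) (Complex.I * unitDir θ) = 0 := by
  have h1 : ∀ θ : ℝ, HasDerivAt (fun θ => F (r * unitDir θ))
      (fderiv ℝ F (r * unitDir θ) (r * (Complex.I * unitDir θ))) θ := fun θ =>
    ((hF.differentiable (by simp) _).hasFDerivAt).comp_hasDerivAt θ
      ((hasDerivAt_unitDir θ).const_mul (r : ℂ))
  have h2 : ∀ θ : ℝ, fderiv ℝ F (r * unitDir θ) (r * (Complex.I * unitDir θ))
      = r • fderiv ℝ F (r * unitDir θ) (Complex.I * unitDir θ) := fun θ => by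
    rw [← map_smul, Complex.real_smul]
  have hcont : Continuous fun θ => fderiv ℝ F (r * unitDir θ) (r * (Complex.I * unitDir θ)) :=
    ((hF.continuous_fderiv (by simp)).comp (continuous_const.mul continuous_unitDir)).clm_apply
      (continuous_const.mul (continuous_const.mul continuous_unitDir))
  have h3 := intervalIntegral.integral_eq_sub_of_hasDerivAt (a := -Real.pi) (b := Real.pi)
    (fun θ _ => h1 θ) (hcont.intervalIntegrable _ _)
  rw [intervalIntegral.integral_of_le (by linarith [Real.pi_pos]), integral_Ioc_eq_integral_Ioo] at h3
  simp only [h2] at h3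
  rw [integral_smul] at h3
  have h4 : unitDir Real.pi = unitDir (-Real.pi) := by simp [unitDir]
  rw [h4, sub_self] at h3
  exact (smul_eq_zero.1 h3).resolve_left hr.ne'

/-- In polar coordinates `F_x + i F_y = e^{iθ}(∂_r + (i/r) ∂_θ) F`. Division by `z = r e^{iθ}`
cancels both the phase and the factor `r` of the area element, so the singular integrand becomes the
continuous `A + i B`, with `A` radial and `B` angular. -/
lemma integral_dbar_div_self (hF : ContDiff ℝ 1 F) (hc : HasCompactSupport F) :
    ∫ z, (fderiv ℝ F z 1 + Complex.I * fderiv ℝ F z Complex.I) / z = -(2 * Real.pi * F 0) := by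
  rw [← Complex.integral_comp_polarCoord_symm]
  set A : ℝ × ℝ → ℂ := fun p => fderiv ℝ F (p.1 * unitDir p.2) (unitDir p.2) with hA
  set B : ℝ × ℝ → ℂ := fun p => fderiv ℝ F (p.1 * unitDir p.2) (Complex.I * unitDir p.2) with hB
  have hcF := hF.continuous_fderiv (by simp)
  have hcu : Continuous fun p : ℝ × ℝ => unitDir p.2 := continuous_unitDir.comp continuous_snd
  have hcp : Continuous fun p : ℝ × ℝ => (p.1 : ℂ) * unitDir p.2 :=
    (Complex.continuous_ofReal.comp continuous_fst).mul hcu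
  have cA : Continuous A := (hcF.comp hcp).clm_apply hcu
  have cB : Continuous B := (hcF.comp hcp).clm_apply (continuous_const.mul hcu)
  obtain ⟨R, hR⟩ := (hc.fderiv (𝕜 := ℝ)).isCompact.isBounded.subset_closedBall 0
  have hz : ∀ p : ℝ × ℝ, max R 0 < p.1 → fderiv ℝ F (p.1 * unitDir p.2) = 0 := by
    intro p hp
    refine image_eq_zero_of_notMem_tsupport fun h => ?_
    have := hR h
    simp only [mem_closedBall_zero_iff, norm_mul, norm_unitDir, Complex.norm_real, mul_one] at this
    exact absurd ((Real.le_norm_self _).trans this) (not_le.2 ((le_max_left _ _).trans_lt hp))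
  have iA := integrableOn_polar_target cA (R := max R 0) fun p hp => by simp [hA, hz p hp]
  have iB := integrableOn_polar_target cB (R := max R 0) fun p hp => by simp [hB, hz p hp]
  have e1 : ∀ p ∈ polarCoord.target, p.1 • ((fderiv ℝ F (Complex.polarCoord.symm p) 1
      + Complex.I * fderiv ℝ F (Complex.polarCoord.symm p) Complex.I) / Complex.polarCoord.symm p)
      = A p + Complex.I * B p := by
    intro p hp
    have hp0 : (p.1 : ℂ) ≠ 0 := by
      have : 0 < p.1 := hp.1
      exact_mod_cast this.ne'
    have hs : Complex.polarCoord.symm p = (p.1 : ℂ) * unitDir p.2 := by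
      rw [Complex.polarCoord_symm_apply, unitDir]
    have hu0 : unitDir p.2 ≠ 0 := by
      rw [← norm_ne_zero_iff, norm_unitDir]; exact one_ne_zero
    rw [hs]
    simp only [hA, hB]
    set T := fderiv ℝ F (p.1 * unitDir p.2)
    have t1 : T (unitDir p.2) = Real.cos p.2 * T 1 + Real.sin p.2 * T Complex.I := by
      have : unitDir p.2 = Real.cos p.2 • (1 : ℂ) + Real.sin p.2 • Complex.I := by
        simp [unitDir]
      rw [this, map_add, map_smul, map_smul]; simp
    have t2 : T (Complex.I * unitDir p.2) = -Real.sin p.2 * T 1 + Real.cos p.2 * T Complex.I := by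
      have : Complex.I * unitDir p.2 = (-Real.sin p.2) • (1 : ℂ) + Real.cos p.2 • Complex.I := by
        simp only [unitDir, Complex.real_smul, Complex.ofReal_neg]
        linear_combination (Real.sin p.2 : ℂ) * Complex.I_mul_I
      rw [this, map_add, map_smul, map_smul]; simp
    rw [t1, t2, Complex.real_smul]
    field_simp
    have hcs : (Real.cos p.2 : ℂ) ^ 2 + (Real.sin p.2 : ℂ) ^ 2 = 1 := by
      exact_mod_cast Real.cos_sq_add_sin_sq p.2
    simp only [unitDir]
    linear_combination (-(T 1 + Complex.I * T Complex.I)) * hcs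
      + (Real.sin p.2 ^ 2 * T 1 - Real.cos p.2 * Real.sin p.2 * T Complex.I) * Complex.I_mul_I
  rw [setIntegral_congr_fun polarCoord.open_target.measurableSet e1]
  have ht : polarCoord.target = Ioi (0 : ℝ) ×ˢ Ioo (-Real.pi) Real.pi := rfl
  rw [ht, integral_add iA (iB.const_mul _), integral_const_mul]
  have eB : ∫ p in Ioi (0 : ℝ) ×ˢ Ioo (-Real.pi) Real.pi, B p = 0 := by
    rw [Measure.volume_eq_prod] at iB ⊢
    rw [setIntegral_prod _ iB]
    exact setIntegral_eq_zero_of_forall_eq_zero fun r hr => integral_angular_deriv hF hr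
  have eA : ∫ p in Ioi (0 : ℝ) ×ˢ Ioo (-Real.pi) Real.pi, A p = -(2 * Real.pi * F 0) := by
    rw [Measure.volume_eq_prod] at iA ⊢
    -- The radial integral has to be the inner one here; for `B` it was the angular one.
    rw [← setIntegral_prod_swap, setIntegral_prod (fun z => A z.swap) iA.swap]
    have : ∀ θ : ℝ, ∫ r in Ioi (0 : ℝ), A (θ, r).swap = -F 0 :=
      fun θ => integral_radial_deriv hF hc θ
    simp only [this]
    rw [setIntegral_const]
    have hv : volume.real (Ioo (-Real.pi) Real.pi) = 2 * Real.pi := by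
      rw [Real.volume_real_Ioo_of_le (by linarith [Real.pi_pos])]; ring
    rw [hv, Complex.real_smul]; push_cast; ring
  rw [eA, eB]; simp

/-- The Cauchy–Pompeiu formula for a compactly supported function. -/
lemma integral_dbar_div (hF : ContDiff ℝ 1 F) (hc : HasCompactSupport F) (w : ℂ) :
    ∫ z, (fderiv ℝ F z 1 + Complex.I * fderiv ℝ F z Complex.I) / (z - w)
      = -(2 * Real.pi * F w) := by
  have h := integral_dbar_div_self (F := fun z => F (z + w)) (hF.comp (contDiff_id.add contDiff_const))
    (hc.comp_homeomorph (Homeomorph.addRight w))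
  simp only [zero_add] at h
  rw [← h, ← integral_add_right_eq_self _ w]
  congr 1; ext z
  rw [fderiv_comp_add_right, add_sub_cancel_right]

end Pompeiu

/-! ### Green's formula -/

section Green

/-- The singularity has order `1`, below the dimension `2`. -/
lemma integrable_indicator_inv_norm (R : ℝ) :
    Integrable ((Metric.ball (0 : ℂ) R).indicator fun u => ‖u‖⁻¹) := by
  rw [integrable_indicator_iff measurableSet_ball]
  refine integrableOn_ball_of_norm_le_rpow (C := 1) (α := 1) ?_ ?_ ?_ ?_
  · simp
  · simp
  · exact ae_of_all _ fun x => by simp [Real.rpow_neg_one]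
  · exact measurable_norm.inv.aestronglyMeasurable

variable {Ω : Set ℂ} {γ : ℝ → ℂ} {F : ℂ → ℂ}

/-- The curve is the image of a null segment of the plane under the differentiable map `γ ∘ re`, and
such maps preserve null sets. -/
lemma volume_image_Icc_eq_zero (hγ : DifferentiableOn ℝ γ (Icc 0 1)) :
    volume (γ '' Icc 0 1) = 0 := by
  set S : Set ℂ := {z : ℂ | z.re ∈ Icc (0 : ℝ) 1 ∧ z.im = 0}
  have hS : volume S = 0 := by
    have : S ⊆ (LinearMap.ker Complex.imLm : Submodule ℝ ℂ) := fun z hz => hz.2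
    refine measure_mono_null this (Measure.addHaar_submodule _ _ fun h => ?_)
    have : Complex.I ∈ LinearMap.ker Complex.imLm := h ▸ Submodule.mem_top
    simp at this
  have hd : DifferentiableOn ℝ (fun z : ℂ => γ z.re) S :=
    hγ.comp Complex.reCLM.differentiable.differentiableOn fun z hz => hz.1
  have := addHaar_image_eq_zero_of_differentiableOn_of_addHaar_eq_zero volume hd hS
  refine measure_mono_null ?_ this
  rintro _ ⟨t, ht, rfl⟩
  exact ⟨(t : ℂ), ⟨by simpa using ht, by simp⟩, by simp⟩

lemma IsBoundaryParam.windingNumber_ae (hΩ : IsOpen Ω) (hγ : IsBoundaryParam Ω γ) :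
    ∀ᵐ z, windingNumber γ z = Ω.indicator 1 z := by
  have h0 : volume (frontier Ω) = 0 := by
    rw [← hγ.image]
    exact volume_image_Icc_eq_zero (hγ.contDiff.differentiableOn (by simp))
  filter_upwards [compl_mem_ae_iff.2 h0] with z hz
  by_cases hzΩ : z ∈ Ω
  · rw [hγ.winding_inside z hzΩ, indicator_of_mem hzΩ]; rfl
  · rw [indicator_of_notMem hzΩ]
    refine hγ.winding_outside z fun h => hz ?_
    rw [hΩ.frontier_eq]; exact ⟨h, hzΩ⟩

/-- At the endpoints `deriv γ` depends on values of `γ` outside `[0,1]`, about which nothing is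
known; this discards them. -/
lemma deriv_ae_eq_derivWithin (γ : ℝ → ℂ) :
    ∀ᵐ t ∂(volume.restrict (Ioc (0 : ℝ) 1)), derivWithin γ (Icc 0 1) t = deriv γ t := by
  rw [← restrict_Ioo_eq_restrict_Ioc, ae_restrict_iff' measurableSet_Ioo]
  exact ae_of_all _ fun t ht => derivWithin_of_mem_nhds (Icc_mem_nhds ht.1 ht.2)

/-- The hypothesis for Fubini. The kernel is dominated by a constant times a truncated `1/|u|`
evaluated at `z - γ t`, whose integral over `z` does not depend on `t`. -/
lemma integrable_kernel (hγ : ContDiffOn ℝ 1 γ (Icc 0 1)) {D : ℂ → ℂ} (hD : Continuous D)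
    (hDc : HasCompactSupport D) :
    Integrable (fun x : ℝ × ℂ => deriv γ x.1 * (D x.2 / (x.2 - γ x.1)))
      ((volume.restrict (Ioc (0 : ℝ) 1)).prod volume) := by
  have hm : AEStronglyMeasurable (fun x : ℝ × ℂ => deriv γ x.1 * (D x.2 / (x.2 - γ x.1)))
      ((volume.restrict (Ioc (0 : ℝ) 1)).prod volume) := by
    have m1 : AEMeasurable γ (volume.restrict (Ioc (0 : ℝ) 1)) :=
      (hγ.continuousOn.mono Ioc_subset_Icc_self).aemeasurable measurableSet_Ioc
    have m2 : AEMeasurable (fun x : ℝ × ℂ => γ x.1)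
      ((volume.restrict (Ioc (0 : ℝ) 1)).prod volume) := m1.comp_fst
    have m3 : AEMeasurable (fun x : ℝ × ℂ => deriv γ x.1)
      ((volume.restrict (Ioc (0 : ℝ) 1)).prod volume) :=
      ((measurable_deriv γ).comp measurable_fst).aemeasurable
    have m4 : AEMeasurable (fun x : ℝ × ℂ => D x.2)
      ((volume.restrict (Ioc (0 : ℝ) 1)).prod volume) :=
      (hD.measurable.comp measurable_snd).aemeasurable
    exact (m3.mul (m4.div (measurable_snd.aemeasurable.sub m2))).aestronglyMeasurable
  obtain ⟨C, hC⟩ := isCompact_Icc.exists_bound_of_continuousOn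
    (hγ.continuousOn_derivWithin (uniqueDiffOn_Icc one_pos) le_rfl)
  obtain ⟨G, hG⟩ := isCompact_Icc.exists_bound_of_continuousOn hγ.continuousOn
  obtain ⟨M, hM⟩ := hDc.exists_bound_of_continuous hD
  obtain ⟨R, hR⟩ := hDc.isCompact.isBounded.subset_closedBall 0
  -- On the support of `D`, `‖z - γ t‖ ≤ R + G`; the extra `1` is there because the ball is open.
  set κ := (Metric.ball (0 : ℂ) (R + G + 1)).indicator fun u => ‖u‖⁻¹ with hκ
  have iκ : Integrable κ := integrable_indicator_inv_norm _
  have hM0 : 0 ≤ M := (norm_nonneg _).trans (hM 0)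
  have hC0 : 0 ≤ C := (norm_nonneg _).trans (hC 0 (by simp))
  have κ0 : ∀ u, 0 ≤ κ u := fun u => indicator_nonneg (fun _ _ => by positivity) _
  have bound : ∀ t ∈ Icc (0 : ℝ) 1, ∀ z, ‖D z / (z - γ t)‖ ≤ M * κ (z - γ t) := by
    intro t ht z
    by_cases hz : z ∈ tsupport D
    · have hz' : ‖z‖ ≤ R := by simpa using hR hz
      have hmem : z - γ t ∈ Metric.ball (0 : ℂ) (R + G + 1) := by
        rw [mem_ball_zero_iff]
        linarith [norm_sub_le z (γ t), hG t ht]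
      rw [hκ, indicator_of_mem hmem, norm_div, div_eq_mul_inv]
      gcongr
      exact hM z
    · rw [image_eq_zero_of_notMem_tsupport hz, zero_div, norm_zero]
      exact mul_nonneg hM0 (κ0 _)
  have iκt : ∀ w, Integrable fun z => κ (z - w) := fun w => iκ.comp_sub_right w
  rw [integrable_prod_iff hm]
  have hbd : ∀ᵐ t ∂(volume.restrict (Ioc (0 : ℝ) 1)), ‖deriv γ t‖ ≤ C ∧ t ∈ Icc (0 : ℝ) 1 := by
    filter_upwards [deriv_ae_eq_derivWithin γ, ae_restrict_mem measurableSet_Ioc] with t h1 h2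
    have := Ioc_subset_Icc_self h2
    exact ⟨h1 ▸ hC t this, this⟩
  have hpt : ∀ᵐ t ∂(volume.restrict (Ioc (0 : ℝ) 1)), ∀ z,
      ‖deriv γ t * (D z / (z - γ t))‖ ≤ C * M * κ (z - γ t) := by
    filter_upwards [hbd] with t ht z
    rw [norm_mul, mul_assoc]
    exact mul_le_mul ht.1 (bound t ht.2 z) (norm_nonneg _) hC0
  have hint : ∀ᵐ t ∂(volume.restrict (Ioc (0 : ℝ) 1)),
      Integrable (fun z => deriv γ t * (D z / (z - γ t))) := by
    filter_upwards [hpt] with t ht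
    refine ((iκt (γ t)).const_mul (C * M)).mono' ?_ (ae_of_all _ ht)
    exact (measurable_const.mul (hD.measurable.div (measurable_id.sub_const _))).aestronglyMeasurable
  refine ⟨hint, ?_⟩
  refine Integrable.of_bound hm.norm.integral_prod_right' (C * M * ∫ z, κ z) ?_
  filter_upwards [hpt, hint] with t ht hi
  rw [Real.norm_of_nonneg (integral_nonneg fun _ => norm_nonneg _)]
  refine (integral_mono hi.norm ((iκt (γ t)).const_mul (C * M)) ht).trans (le_of_eq ?_)
  rw [integral_const_mul, integral_sub_right_eq_self κ]

/-- Green's formula in complex form. -/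
lemma IsBoundaryParam.integral_dbar (hΩ : IsOpen Ω) (hγ : IsBoundaryParam Ω γ)
    (hF : ContDiff ℝ 1 F) (hc : HasCompactSupport F) :
    ∫ t in (0 : ℝ)..1, F (γ t) * deriv γ t =
      Complex.I * ∫ z in Ω, (fderiv ℝ F z 1 + Complex.I * fderiv ℝ F z Complex.I) := by
  set D : ℂ → ℂ := fun z => fderiv ℝ F z 1 + Complex.I * fderiv ℝ F z Complex.I with hDdef
  have hcF := hF.continuous_fderiv (by simp)
  have hD : Continuous D :=
    (hcF.clm_apply continuous_const).add (continuous_const.mul (hcF.clm_apply continuous_const))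
  have hDc : HasCompactSupport D :=
    (hc.fderiv_apply (𝕜 := ℝ) 1).add (hc.fderiv_apply (𝕜 := ℝ) Complex.I).mul_left
  have hK := integrable_kernel (hγ.contDiff.of_le (by norm_num)) hD hDc
  -- Integrating first in `z` gives `-2π F(γ t)` by Cauchy–Pompeiu; integrating first in `t` gives
  -- the winding number about `z`.
  have hswap := integral_integral_swap (f := fun t z => deriv γ t * (D z / (z - γ t))) hK
  have hpi : (2 * Real.pi : ℂ) ≠ 0 := by
    simp [Real.pi_ne_zero]
  have e1 : ∫ t in Ioc (0 : ℝ) 1, ∫ z, deriv γ t * (D z / (z - γ t))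
      = -(2 * Real.pi) * ∫ t in (0 : ℝ)..1, F (γ t) * deriv γ t := by
    rw [intervalIntegral.integral_of_le zero_le_one, ← integral_const_mul]
    congr 1; ext t
    rw [integral_const_mul, integral_dbar_div hF hc]; ring
  have e2 : ∫ z, ∫ t in Ioc (0 : ℝ) 1, deriv γ t * (D z / (z - γ t))
      = -(2 * Real.pi * Complex.I) * ∫ z in Ω, D z := by
    rw [← integral_indicator hΩ.measurableSet, ← integral_const_mul]
    refine integral_congr_ae ?_
    filter_upwards [hγ.windingNumber_ae hΩ] with z hz
    have h1 : ∫ t in Ioc (0 : ℝ) 1, deriv γ t * (D z / (z - γ t))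
        = -D z * ∫ t in (0 : ℝ)..1, deriv γ t / (γ t - z) := by
      rw [intervalIntegral.integral_of_le zero_le_one, ← integral_const_mul]
      congr 1; ext t
      rw [← neg_sub (γ t) z, div_neg]; ring
    have h2 : ∫ t in (0 : ℝ)..1, deriv γ t / (γ t - z)
        = 2 * Real.pi * Complex.I * windingNumber γ z := by
      rw [windingNumber]; field_simp [Complex.I_ne_zero]
    rw [h1, h2, hz]
    by_cases hzΩ : z ∈ Ω
    · simp [hzΩ]; ring
    · simp [hzΩ]
  rw [e1, e2] at hswap
  apply mul_left_cancel₀ hpi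
  linear_combination -hswap

end Green

/-! ### The integral of a Jacobian as a line integral along the boundary. -/

section Jacobian

variable {Ω : Set ℂ} {γ : ℝ → ℂ}

lemma IsBoundaryParam.continuousOn (hγ : IsBoundaryParam Ω γ) : ContinuousOn γ (Icc 0 1) :=
  hγ.contDiff.continuousOn

lemma IsBoundaryParam.continuousOn_derivWithin (hγ : IsBoundaryParam Ω γ) :
    ContinuousOn (derivWithin γ (Icc 0 1)) (Icc 0 1) :=
  hγ.contDiff.continuousOn_derivWithin (uniqueDiffOn_Icc one_pos) (by norm_num)

lemma IsBoundaryParam.integrable_of_continuousOn {E : Type*} [NormedAddCommGroup E]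
    (hγ : IsBoundaryParam Ω γ) {H : ℂ → ℂ → E}
    (hH : Continuous (Function.uncurry H)) :
    Integrable (fun t => H (γ t) (deriv γ t)) (volume.restrict (Ioc (0 : ℝ) 1)) := by
  have h1 : ContinuousOn (fun t => H (γ t) (derivWithin γ (Icc 0 1) t)) (Icc 0 1) :=
    hH.comp_continuousOn (hγ.continuousOn.prodMk hγ.continuousOn_derivWithin)
  have h2 : IntegrableOn (fun t => H (γ t) (derivWithin γ (Icc 0 1) t)) (Ioc 0 1) :=
    (h1.integrableOn_compact isCompact_Icc).mono_set Ioc_subset_Icc_self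
  refine Integrable.congr h2 ?_
  filter_upwards [deriv_ae_eq_derivWithin γ] with t ht
  rw [ht]

/-- Green's formula for a compactly supported `C¹` vector field. -/
lemma IsBoundaryParam.green (hΩ : IsOpen Ω) (hγ : IsBoundaryParam Ω γ) {A B : ℂ → ℝ}
    (hA : ContDiff ℝ 1 A) (hB : ContDiff ℝ 1 B) (hAc : HasCompactSupport A)
    (hBc : HasCompactSupport B) :
    ∫ z in Ω, (fderiv ℝ B z 1 - fderiv ℝ A z Complex.I) =
      ∫ t in (0 : ℝ)..1, (A (γ t) * (deriv γ t).re + B (γ t) * (deriv γ t).im) := by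
  -- With `F = A - iB`, the real part of `F dz` is `A dx + B dy`, and that of `i(F_x + i F_y)` is
  -- `B_x - A_y`.
  set F : ℂ → ℂ := fun z => (A z : ℂ) - (B z : ℂ) * Complex.I with hFdef
  have hF : ContDiff ℝ 1 F :=
    (Complex.ofRealCLM.contDiff.comp hA).sub ((Complex.ofRealCLM.contDiff.comp hB).mul contDiff_const)
  have hc : HasCompactSupport F := by
    have h1 : HasCompactSupport (fun z => (A z : ℂ)) :=
      hAc.comp_left (g := fun x : ℝ => (x : ℂ)) Complex.ofReal_zero
    have h2 : HasCompactSupport (fun z => (B z : ℂ)) :=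
      hBc.comp_left (g := fun x : ℝ => (x : ℂ)) Complex.ofReal_zero
    exact h1.sub h2.mul_right
  have hfd : ∀ z e, fderiv ℝ F z e = (fderiv ℝ A z e : ℂ) - (fderiv ℝ B z e : ℂ) * Complex.I := by
    intro z e
    have dA := (Complex.ofRealCLM.hasFDerivAt (x := A z)).comp z
      (hA.differentiable (by simp) z).hasFDerivAt
    have dB := (Complex.ofRealCLM.hasFDerivAt (x := B z)).comp z
      (hB.differentiable (by simp) z).hasFDerivAt
    have : HasFDerivAt F _ z := dA.sub (dB.mul_const Complex.I)
    rw [this.fderiv]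
    simp [mul_comm]
  have h := hγ.integral_dbar hΩ hF hc
  have hre := congrArg Complex.re h
  have hcF := hF.continuous_fderiv (by simp)
  have iD : Integrable (fun z => fderiv ℝ F z 1 + Complex.I * fderiv ℝ F z Complex.I)
      (volume.restrict Ω) :=
    (((hcF.clm_apply continuous_const).add (continuous_const.mul
      (hcF.clm_apply continuous_const))).integrable_of_hasCompactSupport
      ((hc.fderiv_apply (𝕜 := ℝ) 1).add (hc.fderiv_apply (𝕜 := ℝ) Complex.I).mul_left)).integrableOn
  have iγ := hγ.integrable_of_continuousOn (H := fun z w => F z * w)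
    ((hF.continuous.comp continuous_fst).mul continuous_snd)
  rw [← integral_const_mul, intervalIntegral.integral_of_le zero_le_one] at hre
  have c1 := Complex.reCLM.integral_comp_comm (iD.const_mul Complex.I)
  have c2 := Complex.reCLM.integral_comp_comm iγ
  simp only [Complex.reCLM_apply] at c1 c2
  rw [← c1, ← c2] at hre
  rw [intervalIntegral.integral_of_le zero_le_one]
  have r1 : ∀ z, (Complex.I * (fderiv ℝ F z 1 + Complex.I * fderiv ℝ F z Complex.I)).re
      = fderiv ℝ B z 1 - fderiv ℝ A z Complex.I := by
    intro z; simp [hfd]; ring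
  have r2 : ∀ t, (F (γ t) * deriv γ t).re = A (γ t) * (deriv γ t).re + B (γ t) * (deriv γ t).im := by
    intro t; simp [hFdef]
  simp only [r1, r2] at hre
  exact hre.symm

/-- Green's formula for the field `U ∇V`: the terms with second derivatives of `V` cancel by
symmetry. Only `V` needs the extra derivative. -/
lemma IsBoundaryParam.integral_jac_of_contDiff_two (hΩ : IsOpen Ω) (hγ : IsBoundaryParam Ω γ)
    {U V : ℂ → ℝ} (hU : ContDiff ℝ 1 U) (hV : ContDiff ℝ 2 V) (hUc : HasCompactSupport U) :
    ∫ z in Ω, (fderiv ℝ U z 1 * fderiv ℝ V z Complex.I - fderiv ℝ U z Complex.I * fderiv ℝ V z 1) =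
      ∫ t in (0 : ℝ)..1, U (γ t) * fderiv ℝ V (γ t) (deriv γ t) := by
  have hV' : ContDiff ℝ 1 (fderiv ℝ V) := hV.fderiv_right (by norm_num)
  have hVe : ∀ e, ContDiff ℝ 1 (fun z => fderiv ℝ V z e) := fun e => hV'.clm_apply contDiff_const
  have h := hγ.green hΩ (hU.mul (hVe 1)) (hU.mul (hVe Complex.I)) hUc.mul_right hUc.mul_right
  have hfd : ∀ z e e', fderiv ℝ (fun z => U z * fderiv ℝ V z e) z e'
      = fderiv ℝ U z e' * fderiv ℝ V z e + U z * fderiv ℝ (fderiv ℝ V) z e' e := by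
    intro z e e'
    have hd : DifferentiableAt ℝ (fderiv ℝ V) z := hV'.differentiable (by simp) z
    rw [fderiv_fun_mul (hU.differentiable (by simp) z) ((hVe e).differentiable (by simp) z),
      fderiv_clm_apply hd (differentiableAt_const _)]
    simp; ring
  have hs : ∀ z, fderiv ℝ (fderiv ℝ V) z 1 Complex.I = fderiv ℝ (fderiv ℝ V) z Complex.I 1 := fun z =>
    (hV.contDiffAt.isSymmSndFDerivAt (by simp)) 1 Complex.I
  have e1 : ∀ z, fderiv ℝ (fun z => U z * fderiv ℝ V z Complex.I) z 1
      - fderiv ℝ (fun z => U z * fderiv ℝ V z 1) z Complex.I = fderiv ℝ U z 1 * fderiv ℝ V z Complex.I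
        - fderiv ℝ U z Complex.I * fderiv ℝ V z 1 := by
    intro z; rw [hfd, hfd, hs]; ring
  have e2 : ∀ t, U (γ t) * fderiv ℝ V (γ t) 1 * (deriv γ t).re
      + U (γ t) * fderiv ℝ V (γ t) Complex.I * (deriv γ t).im
      = U (γ t) * fderiv ℝ V (γ t) (deriv γ t) := by
    intro t
    conv_rhs => rw [← Complex.re_add_im (deriv γ t)]
    have : ((deriv γ t).re : ℂ) + (deriv γ t).im * Complex.I
        = (deriv γ t).re • (1 : ℂ) + (deriv γ t).im • Complex.I := by simp
    rw [this, map_add, map_smul, map_smul, smul_eq_mul, smul_eq_mul]; ring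
  simp only [e1, e2] at h
  exact h

/-! ### Approximation by smooth functions -/

/-- Mollification. Pointwise convergence and a uniform bound of the gradients are what dominated
convergence requires. -/
lemma exists_smooth_approx {V : ℂ → ℝ} (hV : ContDiff ℝ 1 V) (hc : HasCompactSupport V) :
    ∃ f : ℕ → ℂ → ℝ, (∀ n, ContDiff ℝ 2 (f n)) ∧
      (∀ z, Tendsto (fun n => fderiv ℝ (f n) z) atTop (𝓝 (fderiv ℝ V z))) ∧
      ∃ C, ∀ n z, ‖fderiv ℝ (f n) z‖ ≤ C := by
  let φ : ℕ → ContDiffBump (0 : ℂ) := fun n =>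
    ⟨1 / (n + 1) / 2, 1 / (n + 1), by positivity, by
      have : (0 : ℝ) < 1 / ((n : ℝ) + 1) := by positivity
      linarith⟩
  have hφ : Tendsto (fun n => (φ n).rOut) atTop (𝓝 0) := tendsto_one_div_add_atTop_nhds_zero_nat
  have hcV := hV.continuous_fderiv (by simp)
  let f : ℕ → ℂ → ℝ := fun n =>
    convolution ((φ n).normed volume) V (ContinuousLinearMap.lsmul ℝ ℝ) volume
  have hf' : ∀ n z, fderiv ℝ (f n) z = convolution ((φ n).normed volume) (fderiv ℝ V)
      (ContinuousLinearMap.lsmul ℝ ℝ) volume z := by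
    intro n z
    have := hc.hasFDerivAt_convolution_right (ContinuousLinearMap.lsmul ℝ ℝ)
      (((φ n).continuous_normed (μ := volume)).locallyIntegrable (μ := volume)) hV z
    refine this.fderiv.trans ?_
    simp only [convolution]
    congr 1
  obtain ⟨C, hC⟩ := (hc.fderiv (𝕜 := ℝ)).exists_bound_of_continuous hcV
  refine ⟨f, fun n => ?_, fun z => ?_, 3 * C, fun n z => ?_⟩
  · exact (φ n).hasCompactSupport_normed.contDiff_convolution_left _ (φ n).contDiff_normed
      hV.continuous.locallyIntegrable
  · simp only [hf']
    refine ContDiffBump.convolution_tendsto_right (g := fun _ => fderiv ℝ V) (k := fun _ => z) hφ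
      (Eventually.of_forall fun _ => hcV.aestronglyMeasurable) ?_ tendsto_const_nhds
    exact (hcV.tendsto z).comp tendsto_snd
  · rw [hf']
    -- Gradients bounded by `C` differ by at most `2 * C`, so their average is within `2 * C` of the
    -- value at `z`; adding the value itself gives `3 * C`.
    have hd := ContDiffBump.dist_normed_convolution_le (φ := φ n) (x₀ := z) (ε := 2 * C) (μ := volume)
      hcV.aestronglyMeasurable (fun x _ => by
        rw [dist_eq_norm]
        linarith [norm_sub_le (fderiv ℝ V x) (fderiv ℝ V z), hC x, hC z])
    rw [dist_eq_norm] at hd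
    have := norm_sub_norm_le (convolution ((φ n).normed volume) (fderiv ℝ V)
      (ContinuousLinearMap.lsmul ℝ ℝ) volume z) (fderiv ℝ V z)
    linarith [hC z]

/-- Both sides involve `V` only through its gradient, and linearly, so mollifying `V` alone reduces
to the `C²` case. -/
lemma IsBoundaryParam.integral_jac_of_hasCompactSupport (hΩ : IsOpen Ω)
    (hb : Bornology.IsBounded Ω) (hγ : IsBoundaryParam Ω γ)
    {U V : ℂ → ℝ} (hU : ContDiff ℝ 1 U) (hV : ContDiff ℝ 1 V) (hUc : HasCompactSupport U)
    (hVc : HasCompactSupport V) :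
    ∫ z in Ω, (fderiv ℝ U z 1 * fderiv ℝ V z Complex.I - fderiv ℝ U z Complex.I * fderiv ℝ V z 1) =
      ∫ t in (0 : ℝ)..1, U (γ t) * fderiv ℝ V (γ t) (deriv γ t) := by
  obtain ⟨f, hf, hlim, C, hC⟩ := exists_smooth_approx hV hVc
  have : IsFiniteMeasure (volume.restrict Ω) := ⟨by simpa using hb.measure_lt_top⟩
  have hcU := hU.continuous_fderiv (by simp)
  have hcf : ∀ n, Continuous (fderiv ℝ (f n)) := fun n => (hf n).continuous_fderiv (by simp)
  have hlim' : ∀ z e, Tendsto (fun n => fderiv ℝ (f n) z e) atTop (𝓝 (fderiv ℝ V z e)) := fun z e =>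
    ((ContinuousLinearMap.apply ℝ ℝ e).continuous.tendsto _).comp (hlim z)
  obtain ⟨M, hM⟩ := (hUc.fderiv (𝕜 := ℝ)).exists_bound_of_continuous hcU
  obtain ⟨M', hM'⟩ := hUc.exists_bound_of_continuous hU.continuous
  have hM0 : 0 ≤ M := (norm_nonneg _).trans (hM 0)
  have hM0' : 0 ≤ M' := (norm_nonneg _).trans (hM' 0)
  have hC0 : 0 ≤ C := (norm_nonneg _).trans (hC 0 0)
  have bd : ∀ (T : ℂ →L[ℝ] ℝ) (K : ℝ), ‖T‖ ≤ K → ∀ e, ‖T e‖ ≤ K * ‖e‖ := fun T K h e =>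
    T.le_of_opNorm_le h e
  have l1 : Tendsto (fun n => ∫ z in Ω, (fderiv ℝ U z 1 * fderiv ℝ (f n) z Complex.I
      - fderiv ℝ U z Complex.I * fderiv ℝ (f n) z 1)) atTop (𝓝 (∫ z in Ω,
      (fderiv ℝ U z 1 * fderiv ℝ V z Complex.I - fderiv ℝ U z Complex.I * fderiv ℝ V z 1))) := by
    refine tendsto_integral_of_dominated_convergence (fun _ => M * C + M * C) (fun n => ?_)
      (integrable_const _) (fun n => ae_of_all _ fun z => ?_) (ae_of_all _ fun z => ?_)
    · exact (((hcU.clm_apply continuous_const).mul ((hcf n).clm_apply continuous_const)).sub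
        ((hcU.clm_apply continuous_const).mul
          ((hcf n).clm_apply continuous_const))).aestronglyMeasurable
    · refine (norm_sub_le _ _).trans ?_
      rw [norm_mul, norm_mul]
      have a1 := bd _ _ (hM z) 1
      have a2 := bd _ _ (hM z) Complex.I
      have a3 := bd _ _ (hC n z) 1
      have a4 := bd _ _ (hC n z) Complex.I
      simp only [norm_one, Complex.norm_I, mul_one] at a1 a2 a3 a4
      gcongr
    · exact ((hlim' z _).const_mul _).sub ((hlim' z _).const_mul _)
  have l2 : Tendsto (fun n => ∫ t in (0 : ℝ)..1, U (γ t) * fderiv ℝ (f n) (γ t) (deriv γ t)) atTop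
      (𝓝 (∫ t in (0 : ℝ)..1, U (γ t) * fderiv ℝ V (γ t) (deriv γ t))) := by
    simp only [intervalIntegral.integral_of_le zero_le_one]
    refine tendsto_integral_of_dominated_convergence (fun t => M' * (C * ‖deriv γ t‖)) (fun n => ?_)
      ?_ (fun n => ae_of_all _ fun t => ?_) (ae_of_all _ fun t => ?_)
    · exact (hγ.integrable_of_continuousOn (H := fun z w => U z * fderiv ℝ (f n) z w)
        ((hU.continuous.comp continuous_fst).mul
          (((hcf n).comp continuous_fst).clm_apply continuous_snd))).1
    · exact hγ.integrable_of_continuousOn (H := fun _ w => M' * (C * ‖w‖)) (by fun_prop)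
    · rw [norm_mul]
      exact mul_le_mul (hM' _) (bd _ _ (hC n _) _) (norm_nonneg _) hM0'
    · exact (hlim' _ _).const_mul _
  refine tendsto_nhds_unique l1 (l2.congr fun n => ?_)
  exact (hγ.integral_jac_of_contDiff_two hΩ hU (hf n) hUc).symm

/-- The integral of the Jacobian of a `C¹` map as an integral over the boundary curve. -/
lemma IsBoundaryParam.integral_jac (hΩ : IsOpen Ω)
    (hb : Bornology.IsBounded Ω) (hγ : IsBoundaryParam Ω γ)
    {U V : ℂ → ℝ} (hU : ContDiff ℝ 1 U) (hV : ContDiff ℝ 1 V) :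
    ∫ z in Ω, (fderiv ℝ U z 1 * fderiv ℝ V z Complex.I - fderiv ℝ U z Complex.I * fderiv ℝ V z 1) =
      ∫ t in (0 : ℝ)..1, U (γ t) * deriv (fun τ => V (γ τ)) t := by
  obtain ⟨R, hR0, hR⟩ := hb.closure.subset_ball_lt 0 0
  -- The cutoff is `1` on a ball containing `closure Ω`, so it changes no germ at a point of `Ω` or
  -- of `∂Ω`.
  let χ : ContDiffBump (0 : ℂ) := ⟨R, R + 1, hR0, by linarith⟩
  have hχ : ∀ z ∈ closure Ω, χ =ᶠ[𝓝 z] 1 := fun z hz =>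
    χ.eventuallyEq_one_of_mem_ball (hR hz)
  have hcut : ∀ W : ℂ → ℝ, ∀ z ∈ closure Ω, (fun w => χ w * W w) =ᶠ[𝓝 z] W := by
    intro W z hz
    filter_upwards [hχ z hz] with w hw
    rw [hw]; simp
  have h := hγ.integral_jac_of_hasCompactSupport hΩ hb (χ.contDiff.mul hU) (χ.contDiff.mul hV)
    χ.hasCompactSupport.mul_right χ.hasCompactSupport.mul_right
  have e1 : ∀ z ∈ Ω, (fderiv ℝ (fun w => χ w * U w) z 1 * fderiv ℝ (fun w => χ w * V w) z Complex.I
      - fderiv ℝ (fun w => χ w * U w) z Complex.I * fderiv ℝ (fun w => χ w * V w) z 1)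
      = fderiv ℝ U z 1 * fderiv ℝ V z Complex.I - fderiv ℝ U z Complex.I * fderiv ℝ V z 1 := by
    intro z hz
    rw [(hcut U z (subset_closure hz)).fderiv_eq, (hcut V z (subset_closure hz)).fderiv_eq]
  rw [setIntegral_congr_fun hΩ.measurableSet e1] at h
  rw [h]
  simp only [intervalIntegral.integral_of_le zero_le_one, integral_Ioc_eq_integral_Ioo]
  refine setIntegral_congr_fun measurableSet_Ioo fun t ht => ?_
  have hmem : γ t ∈ closure Ω := by
    have : γ t ∈ frontier Ω := hγ.image ▸ mem_image_of_mem γ (Ioo_subset_Icc_self ht)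
    exact frontier_subset_closure this
  have hd : HasDerivAt γ (deriv γ t) t :=
    ((hγ.contDiff.contDiffAt (Icc_mem_nhds ht.1 ht.2)).differentiableAt (by simp)).hasDerivAt
  have hd' := ((hV.differentiable (by simp) (γ t)).hasFDerivAt).comp_hasDerivAt t hd
  have hd'' : deriv (fun τ => V (γ τ)) t = fderiv ℝ V (γ t) (deriv γ t) := hd'.deriv
  have hUt : χ (γ t) * U (γ t) = U (γ t) := (hcut U _ hmem).self_of_nhds
  rw [hUt, (hcut V _ hmem).fderiv_eq, hd'']

end Jacobian

/-! ### The Sobolev embedding into `L⁴` -/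

section Sobolev

variable {Ω : Set ℂ} {u : ℂ → ℝ}

lemma norm_clm_le (T : ℂ →L[ℝ] ℝ) : ‖T‖ ≤ ‖T 1‖ + ‖T Complex.I‖ := by
  refine T.opNorm_le_bound (by positivity) fun z => ?_
  have : z = z.re • (1 : ℂ) + z.im • Complex.I := by
    simp [Complex.re_add_im]
  calc ‖T z‖ = ‖z.re * T 1 + z.im * T Complex.I‖ := by
        conv_lhs => rw [this, map_add, map_smul, map_smul]
        rfl
    _ ≤ ‖z.re * T 1‖ + ‖z.im * T Complex.I‖ := norm_add_le _ _
    _ = |z.re| * ‖T 1‖ + |z.im| * ‖T Complex.I‖ := by simp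
    _ ≤ ‖z‖ * ‖T 1‖ + ‖z‖ * ‖T Complex.I‖ := by
        gcongr
        · exact Complex.abs_re_le_norm z
        · exact Complex.abs_im_le_norm z
    _ = _ := by ring

lemma eLpNorm_four_thirds_le {E : Type*} [NormedAddCommGroup E] {μ : Measure ℂ}
    {f : ℂ → E} (hf : AEStronglyMeasurable f μ) :
    eLpNorm f ((4 / 3 : NNReal) : ENNReal) μ ≤
      eLpNorm f 2 μ * μ univ ^ (1 / (4 / 3 : ℝ) - 1 / 2) := by
  have := eLpNorm_le_eLpNorm_mul_rpow_measure_univ (μ := μ) (f := f)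
    (p := ((4 / 3 : NNReal) : ENNReal)) (q := ((2 : NNReal) : ENNReal)) (by
      rw [ENNReal.coe_le_coe, ← NNReal.coe_le_coe]; norm_num) hf
  rw [ENNReal.coe_toReal, ENNReal.coe_toReal] at this
  exact_mod_cast this

lemma eLpNorm_fderiv_le {φ : ℂ → ℝ} (hφ : IsTest Ω φ) (μ : Measure ℂ)
    [IsFiniteMeasureOnCompacts μ] :
    eLpNorm (fderiv ℝ φ) 2 μ ≤ eLpNorm (fun z => fderiv ℝ φ z 1) 2 μ
      + eLpNorm (fun z => fderiv ℝ φ z Complex.I) 2 μ := by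
  have m1 := (hφ.fderiv_apply 1).memLp μ
  have m2 := (hφ.fderiv_apply Complex.I).memLp μ
  calc eLpNorm (fderiv ℝ φ) 2 μ
      ≤ eLpNorm ((fun z => ‖fderiv ℝ φ z 1‖) + fun z => ‖fderiv ℝ φ z Complex.I‖) 2 μ :=
        eLpNorm_mono_real fun z => norm_clm_le _
    _ ≤ eLpNorm (fun z => ‖fderiv ℝ φ z 1‖) 2 μ
        + eLpNorm (fun z => ‖fderiv ℝ φ z Complex.I‖) 2 μ :=
        eLpNorm_add_le m1.norm.1 m2.norm.1 (by norm_num)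
    _ = _ := by rw [eLpNorm_norm, eLpNorm_norm]

lemma exists_eLpNorm_le_eLpNorm_fderiv {p q : NNReal} (hp : 1 ≤ p) (hp2 : p < 2)
    (hq : ((p⁻¹ : NNReal) : ℝ) - 2⁻¹ ≤ (q : ℝ)⁻¹) (hb : Bornology.IsBounded Ω) :
    ∃ C : NNReal, ∀ φ : ℂ → ℝ, ContDiff ℝ 1 φ → Function.support φ ⊆ Ω →
      eLpNorm φ q volume ≤ C * eLpNorm (fderiv ℝ φ) p volume :=
  ⟨_, fun _ hφ hs => eLpNorm_le_eLpNorm_fderiv_of_le volume hφ hs hp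
    (by rw [Complex.finrank_real_complex]; exact_mod_cast hp2)
    (by rw [Complex.finrank_real_complex]; exact_mod_cast hq) hb⟩

/-- In dimension two the exponent `2` is critical, but `4/3` has Sobolev conjugate `4`, as `3/4 -
1/2 = 1/4`. On a bounded set Hölder's inequality passes from `L^{4/3}` to `L²`. -/
lemma exists_eLpNorm_four_le (hb : Bornology.IsBounded Ω) :
    ∃ C : NNReal, ∀ φ : ℂ → ℝ, IsTest Ω φ → eLpNorm φ 4 (volume.restrict Ω) ≤
      C * ((eLpNorm (fun z => fderiv ℝ φ z 1) 2 (volume.restrict Ω)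
        + eLpNorm (fun z => fderiv ℝ φ z Complex.I) 2 (volume.restrict Ω)) *
        (volume.restrict Ω) univ ^ (1 / (4 / 3 : ℝ) - 1 / 2)) := by
  obtain ⟨C, hC⟩ := exists_eLpNorm_le_eLpNorm_fderiv (p := 4 / 3) (q := 4)
    (by rw [← NNReal.coe_le_coe]; norm_num) (by rw [← NNReal.coe_lt_coe]; norm_num)
    (by norm_num) hb
  refine ⟨C, fun φ hφ => ?_⟩
  have hcd : ContDiff ℝ 1 φ := hφ.1.of_le (by simp)
  have g := hC φ hcd ((subset_tsupport _).trans hφ.2.2)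
  have s1 : eLpNorm (fderiv ℝ φ) ((4 / 3 : NNReal) : ENNReal) (volume.restrict Ω)
      = eLpNorm (fderiv ℝ φ) ((4 / 3 : NNReal) : ENNReal) volume := by
    have h : Function.support (fun z => ‖fderiv ℝ φ z‖) ⊆ Ω := by
      have h0 : Function.support (fderiv ℝ φ) ⊆ Ω :=
        (subset_tsupport _).trans ((tsupport_fderiv_subset ℝ).trans hφ.2.2)
      exact fun z hz => h0 (by simpa using hz)
    have := eLpNorm_restrict_eq_of_support_subset (p := ((4 / 3 : NNReal) : ENNReal))
      (μ := volume) h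
    rwa [eLpNorm_norm, eLpNorm_norm] at this
  rw [← s1] at g
  have s2 := eLpNorm_four_thirds_le (μ := volume.restrict Ω)
    (hcd.continuous_fderiv (by simp)).aestronglyMeasurable
  have s3 := eLpNorm_fderiv_le hφ (volume.restrict Ω)
  have s4 : eLpNorm φ 4 (volume.restrict Ω) ≤ eLpNorm φ ((4 : NNReal) : ENNReal) volume :=
    eLpNorm_mono_measure _ Measure.restrict_le_self
  refine s4.trans (g.trans ?_)
  gcongr
  exact s2.trans (by gcongr)

/-- The approximating test functions are bounded in `L⁴`; a subsequence converges almost everywhere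
and Fatou's lemma carries the bound to `u`. -/
lemma MemW12Zero.memLp_four (hb : Bornology.IsBounded Ω) (hu : MemW12Zero Ω u) :
    MemLp u 4 (volume.restrict Ω) := by
  have hfin : IsFiniteMeasure (volume.restrict Ω) := ⟨by simpa using hb.measure_lt_top⟩
  choose φ hφ h1 h2 h3 using fun n : ℕ => hu.2 (1 / ((n : ℝ) + 1)) (by positivity)
  set μ : Measure ℂ := volume.restrict Ω with hμ
  have hδ1 : ∀ n : ℕ, ENNReal.ofReal (1 / ((n : ℝ) + 1)) ≤ 1 := fun n => by
    rw [ENNReal.ofReal_le_one, div_le_one (by positivity)]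
    linarith [n.cast_nonneg (α := ℝ)]
  have hpart : ∀ (n : ℕ) (e : ℂ) (D : ℂ → ℝ), MemLp D 2 μ →
      eLpNorm (fun z => D z - fderiv ℝ (φ n) z e) 2 μ ≤ ENNReal.ofReal (1 / ((n : ℝ) + 1)) →
      eLpNorm (fun z => fderiv ℝ (φ n) z e) 2 μ ≤ eLpNorm D 2 μ + 1 := by
    intro n e D hD hle
    have hm := ((hφ n).fderiv_apply e).memLp μ
    have : (fun z => fderiv ℝ (φ n) z e) = D - (fun z => D z - fderiv ℝ (φ n) z e) := by
      ext z; simp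
    rw [this]
    exact (eLpNorm_sub_le hD.1 (hD.sub hm).1 (by norm_num)).trans
      (add_le_add le_rfl (hle.trans (hδ1 n)))
  obtain ⟨C, hC⟩ := exists_eLpNorm_four_le hb
  set K : ENNReal := (C : ENNReal) *
    ((eLpNorm (Dx Ω u) 2 μ + 1 + (eLpNorm (Dy Ω u) 2 μ + 1)) *
      μ univ ^ (1 / (4 / 3 : ℝ) - 1 / 2)) with hK
  have hKtop : K ≠ ⊤ := by
    refine ENNReal.mul_ne_top ENNReal.coe_ne_top (ENNReal.mul_ne_top ?_ ?_)
    · have a := hu.1.memLp_Dx.2.ne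
      have b := hu.1.memLp_Dy.2.ne
      simp only [ne_eq, ENNReal.add_eq_top, ENNReal.one_ne_top, or_false, not_or]
      exact ⟨a, b⟩
    · exact ENNReal.rpow_ne_top_of_nonneg (by norm_num) (measure_ne_top μ univ)
  have hbound : ∀ n, eLpNorm (φ n) 4 μ ≤ K := fun n =>
    (hC (φ n) (hφ n)).trans (by
      rw [hK]
      gcongr
      · exact hpart n 1 _ hu.1.memLp_Dx (h2 n)
      · exact hpart n Complex.I _ hu.1.memLp_Dy (h3 n))
  have hlim : Tendsto (fun n => eLpNorm (φ n - u) 2 μ) atTop (𝓝 0) := by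
    have h0 : Tendsto (fun n : ℕ => ENNReal.ofReal (1 / ((n : ℝ) + 1))) atTop (𝓝 0) := by
      have := ENNReal.tendsto_ofReal (tendsto_one_div_add_atTop_nhds_zero_nat (𝕜 := ℝ))
      simpa using this
    refine tendsto_of_tendsto_of_tendsto_of_le_of_le tendsto_const_nhds h0 (fun _ => zero_le)
      fun n => ?_
    simp only
    rw [eLpNorm_sub_comm]
    exact h1 n
  have hmeas : ∀ n, AEStronglyMeasurable (φ n) μ := fun n => (hφ n).1.continuous.aestronglyMeasurable
  obtain ⟨ns, -, hns⟩ := (tendstoInMeasure_of_tendsto_eLpNorm (by norm_num) hmeas hu.1.memLp.1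
    hlim).exists_seq_tendsto_ae
  refine ⟨hu.1.memLp.1, ?_⟩
  have := Lp.eLpNorm_lim_le_liminf_eLpNorm (p := 4) (fun n => hmeas (ns n)) u hns
  refine lt_of_le_of_lt (this.trans ?_) hKtop.lt_top
  exact liminf_le_of_frequently_le' (Frequently.of_forall fun n => hbound (ns n))

lemma EqOnBoundary.memLp_four {g : ℂ → ℝ} (hb : Bornology.IsBounded Ω)
    (hu : EqOnBoundary Ω u g) : MemLp u 4 (volume.restrict Ω) := by
  obtain ⟨-, U, hU, -, h⟩ := hu
  have := (h.memLp_four hb).add (memLp_restrict_of_continuous hb hU.continuous 4)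
  refine this.ae_eq (ae_of_all _ fun z => ?_)
  simp

end Sobolev

/-! ### The bulk density -/

section Bulk

variable {s : ℝ} {fb : Mat3 → ℝ}

lemma isQTensor_Qpr (p₁ p₂ r : ℝ) : IsQTensor (Qpr p₁ p₂ r) := by
  constructor
  · ext i j
    fin_cases i <;> fin_cases j <;> simp [Qpr]
  · simp [Matrix.trace_fin_three, Qpr]; ring

/-- Conjugation by a rotation of angle `α` about the third axis turns `p` by `2α`; hence the half
angle of `arg (p₁ + i p₂)` below. -/
lemma IsBulk.fb_Qpr (hfb : IsBulk s fb) (p₁ p₂ r : ℝ) :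
    fb (Qpr p₁ p₂ r) = gb fb (p₁ ^ 2 + p₂ ^ 2) r := by
  set w : ℂ := ⟨p₁, p₂⟩
  set c := Real.cos (Complex.arg w / 2)
  set d := Real.sin (Complex.arg w / 2)
  have hcd : c ^ 2 + d ^ 2 = 1 := Real.cos_sq_add_sin_sq _
  have hn : Real.sqrt (p₁ ^ 2 + p₂ ^ 2) = ‖w‖ := by
    rw [Complex.norm_eq_sqrt_sq_add_sq]
  have h1 : ‖w‖ * (c ^ 2 - d ^ 2) = p₁ := by
    have : c ^ 2 - d ^ 2 = Real.cos (Complex.arg w) := by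
      rw [← Real.cos_two_mul', mul_div_cancel₀ _ two_ne_zero]
    rw [this]; exact Complex.norm_mul_cos_arg w
  have h2 : ‖w‖ * (2 * d * c) = p₂ := by
    have : 2 * d * c = Real.sin (Complex.arg w) := by
      rw [← Real.sin_two_mul, mul_div_cancel₀ _ two_ne_zero]
    rw [this]; exact Complex.norm_mul_sin_arg w
  set R : Mat3 := !![c, -d, 0; d, c, 0; 0, 0, 1] with hR
  have hRo : R ∈ Matrix.orthogonalGroup (Fin 3) ℝ := by
    rw [Matrix.mem_orthogonalGroup_iff]
    ext i j
    fin_cases i <;> fin_cases j <;>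
      simp [hR, Matrix.mul_apply, Fin.sum_univ_three] <;>
      nlinarith [hcd]
  rw [gb, hn, ← hfb.frame _ (isQTensor_Qpr ‖w‖ 0 r) R hRo]
  congr 1
  ext i j
  fin_cases i <;> fin_cases j <;>
    simp [hR, Qpr, Matrix.mul_apply, Fin.sum_univ_three] <;>
    first
    | linear_combination (-h1) - r / 2 * hcd
    | linear_combination h1 - r / 2 * hcd
    | linear_combination -h2

lemma Qpr_eq_coordMat (p₁ p₂ r : ℝ) :
    Qpr p₁ p₂ r = coordMat ![p₁ + r / 2, p₂, r / 2 - p₁, 0, 0] := by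
  ext i j
  fin_cases i <;> fin_cases j <;> simp [Qpr, coordMat]
  ring

lemma IsBulk.contDiff_fb_Qpr (hfb : IsBulk s fb) :
    ContDiff ℝ ∞ (fun x : ℝ × ℝ × ℝ => fb (Qpr x.1 x.2.1 x.2.2)) := by
  simp only [Qpr_eq_coordMat]
  refine hfb.smooth.comp (contDiff_pi.2 fun i => ?_)
  fin_cases i <;> simp <;> fun_prop

/-- The bulk density grows at most like the fourth power. -/
lemma IsBulk.growth (hfb : IsBulk s fb) :
    ∃ C : ℝ, 0 ≤ C ∧ ∀ p₁ p₂ r : ℝ,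
      |gb fb (p₁ ^ 2 + p₂ ^ 2) r| ≤ C * (1 + p₁ ^ 4 + p₂ ^ 4 + r ^ 4) := by
  obtain ⟨m₁, m₂, hm₁, hm₂, hd⟩ := hfb.gb_deriv
  have hder : ∀ t r : ℝ, HasDerivAt (fun r' => gb fb t r') (deriv (fun r' => gb fb t r') r) r := by
    intro t r
    have : Differentiable ℝ (fun r' => gb fb t r') := by
      have h := hfb.contDiff_fb_Qpr.differentiable (by simp)
      exact h.comp (g := fun x : ℝ × ℝ × ℝ => fb (Qpr x.1 x.2.1 x.2.2))
        (f := fun r' : ℝ => (Real.sqrt t, (0 : ℝ), r')) (by fun_prop)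
    exact (this r).hasDerivAt
  -- The variable is `σ = |p|` rather than its square, since the hypothesis bounds `g_{b,𝔭} |p|`,
  -- which is half the derivative of `g_b(σ², r)` in `σ`.
  have hder' : ∀ r σ : ℝ, 0 ≤ σ → HasDerivWithinAt (fun σ => gb fb (σ ^ 2) r)
      (derivWithin (fun t => gb fb t r) (Ici 0) (σ ^ 2) * (2 * σ)) (Ici 0) σ := by
    intro r σ hσ
    have h1 : DifferentiableWithinAt ℝ (fun t => gb fb t r) (Ici 0) (σ ^ 2) := by
      have := (hfb.gb_smooth.differentiableOn (by simp)) (σ ^ 2, r) ⟨sq_nonneg σ, mem_univ _⟩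
      exact this.comp (g := fun x : ℝ × ℝ => gb fb x.1 x.2) (f := fun t : ℝ => (t, r)) (σ ^ 2)
        (by fun_prop) fun t ht => ⟨ht, mem_univ _⟩
    have h2 : HasDerivWithinAt (fun σ : ℝ => σ ^ 2) (2 * σ) (Ici 0) σ := by
      simpa using (hasDerivAt_pow 2 σ).hasDerivWithinAt
    exact HasDerivWithinAt.comp (h₂ := fun t => gb fb t r) (h := fun σ : ℝ => σ ^ 2) σ
      h1.hasDerivWithinAt h2 fun x _ => sq_nonneg x
  -- The derivative bounds are integrated from `(0, 0)` to `(0, r)` and then to `(ρ, r)`.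
  have hr : ∀ r : ℝ, |gb fb 0 r - gb fb 0 0| ≤ (m₁ * |r| ^ 3 + m₂) * |r| := by
    intro r
    have := (convex_Icc (-|r|) |r|).norm_image_sub_le_of_norm_hasDerivWithin_le
      (f := fun r' => gb fb 0 r') (C := m₁ * |r| ^ 3 + m₂)
      (fun x _ => (hder 0 x).hasDerivWithinAt) (fun x hx => by
        have h := hd 0 x le_rfl
        have hx' : |x| ≤ |r| := abs_le.2 hx
        have h3 : |x| ^ 3 ≤ |r| ^ 3 := by gcongr
        simp only [mul_zero, zero_add, ne_eq, OfNat.ofNat_ne_zero, not_false_eq_true, zero_pow] at h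
        rw [Real.norm_eq_abs]
        nlinarith) (x := 0) (y := r) (by simp) ⟨neg_abs_le r, le_abs_self r⟩
    simpa using this
  have hρ : ∀ ρ r : ℝ, 0 ≤ ρ →
      |gb fb (ρ ^ 2) r - gb fb 0 r| ≤ 2 * (m₁ * (ρ ^ 3 + |r| ^ 3) + m₂) * ρ := by
    intro ρ r h0
    have := (convex_Icc 0 ρ).norm_image_sub_le_of_norm_hasDerivWithin_le
      (f := fun σ => gb fb (σ ^ 2) r) (C := 2 * (m₁ * (ρ ^ 3 + |r| ^ 3) + m₂))
      (fun x hx => (hder' r x hx.1).mono Icc_subset_Ici_self) (fun x hx => by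
        have h := hd x r hx.1
        have h3 : x ^ 3 ≤ ρ ^ 3 := pow_le_pow_left₀ hx.1 hx.2 3
        rw [Real.norm_eq_abs, abs_mul, abs_of_nonneg (by linarith [hx.1] : (0 : ℝ) ≤ 2 * x)]
        have := abs_nonneg (deriv (fun r' => gb fb (x ^ 2) r') r)
        nlinarith) (x := 0) (y := ρ) ⟨le_rfl, h0⟩ ⟨h0, le_rfl⟩
    simpa [abs_of_nonneg h0] using this
  -- The coefficients absorb `y³ρ ≤ y⁴ + ρ⁴` and `x ≤ 1 + x⁴`; the outer `2` comes from `ρ⁴ ≤ 2(p₁⁴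
  -- + p₂⁴)`.
  refine ⟨2 * (|gb fb 0 0| + 5 * m₁ + 3 * m₂), by positivity, fun p₁ p₂ r => ?_⟩
  set ρ := Real.sqrt (p₁ ^ 2 + p₂ ^ 2) with hρdef
  have hρ2 : ρ ^ 2 = p₁ ^ 2 + p₂ ^ 2 := Real.sq_sqrt (by positivity)
  have hρ0 : 0 ≤ ρ := Real.sqrt_nonneg _
  have k1 := hr r
  have k2 := hρ ρ r hρ0
  rw [← hρ2]
  have hρ4 : ρ ^ 4 ≤ 2 * (p₁ ^ 4 + p₂ ^ 4) := by
    have : ρ ^ 4 = (p₁ ^ 2 + p₂ ^ 2) ^ 2 := by rw [← hρ2]; ring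
    rw [this]; nlinarith [sq_nonneg (p₁ ^ 2 - p₂ ^ 2)]
  set y := |r| with hy
  have hy0 : 0 ≤ y := abs_nonneg r
  have hy4 : r ^ 4 = y ^ 4 := by rw [hy, Even.pow_abs (by decide)]
  have j1 : y ^ 3 * ρ ≤ y ^ 4 + ρ ^ 4 := by
    rcases le_total y ρ with h | h
    · have : y ^ 3 * ρ ≤ ρ ^ 3 * ρ := by gcongr
      nlinarith [pow_nonneg hy0 4]
    · have : y ^ 3 * ρ ≤ y ^ 3 * y := by gcongr
      nlinarith [pow_nonneg hρ0 4]
  have j2 : ∀ x : ℝ, 0 ≤ x → x ≤ 1 + x ^ 4 := by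
    intro x _
    nlinarith [sq_nonneg (x ^ 2 - 1), sq_nonneg (x - 1), sq_nonneg (x ^ 2), sq_nonneg x]
  have j3 := j2 y hy0
  have j4 := j2 ρ hρ0
  have tri : |gb fb (ρ ^ 2) r| ≤ |gb fb 0 0| + (m₁ * y ^ 3 + m₂) * y
      + 2 * (m₁ * (ρ ^ 3 + y ^ 3) + m₂) * ρ := by
    have : gb fb (ρ ^ 2) r = gb fb 0 0 + (gb fb 0 r - gb fb 0 0) + (gb fb (ρ ^ 2) r - gb fb 0 r) := by
      ring
    rw [this]
    exact (abs_add_three _ _ _).trans (by gcongr)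
  have st : |gb fb 0 0| + (m₁ * y ^ 3 + m₂) * y + 2 * (m₁ * (ρ ^ 3 + y ^ 3) + m₂) * ρ
      ≤ (|gb fb 0 0| + 5 * m₁ + 3 * m₂) * (1 + ρ ^ 4 + y ^ 4) := by
    have a1 := mul_le_mul_of_nonneg_left j1 hm₁.le
    have a2 := mul_le_mul_of_nonneg_left j3 hm₂.le
    have a3 := mul_le_mul_of_nonneg_left j4 hm₂.le
    have b1 : 0 ≤ |gb fb 0 0| * (ρ ^ 4 + y ^ 4) := by positivity
    have b2 : 0 ≤ m₁ * ρ ^ 4 := by positivity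
    have b3 : 0 ≤ m₁ * y ^ 4 := by positivity
    have b4 : 0 ≤ m₂ * ρ ^ 4 := by positivity
    have b5 : 0 ≤ m₂ * y ^ 4 := by positivity
    nlinarith
  refine tri.trans (st.trans ?_)
  have hc : 0 ≤ |gb fb 0 0| + 5 * m₁ + 3 * m₂ := by positivity
  rw [hy4, mul_comm 2, mul_assoc]
  refine mul_le_mul_of_nonneg_left ?_ hc
  nlinarith [pow_nonneg hy0 4, pow_nonneg (sq_nonneg p₁) 2]

end Bulk

/-! ### The null Lagrangian -/

section NullLagrangian

variable {Ω : Set ℂ} {γ : ℝ → ℂ}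

lemma IsBoundaryParam.integrable_mul_deriv (hγ : IsBoundaryParam Ω γ) {U V : ℂ → ℝ}
    (hU : ContDiff ℝ 1 U) (hV : ContDiff ℝ 1 V) :
    Integrable (fun t => U (γ t) * deriv (fun τ => V (γ τ)) t)
      (volume.restrict (Ioo (0 : ℝ) 1)) := by
  have h := hγ.integrable_of_continuousOn (H := fun z w => U z * fderiv ℝ V z w)
    ((hU.continuous.comp continuous_fst).mul
      (((hV.continuous_fderiv (by simp)).comp continuous_fst).clm_apply continuous_snd))
  rw [← restrict_Ioo_eq_restrict_Ioc] at h
  refine h.congr ((ae_restrict_iff' measurableSet_Ioo).2 (ae_of_all _ fun t ht => ?_))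
  have hd : HasDerivAt γ (deriv γ t) t :=
    ((hγ.contDiff.contDiffAt (Icc_mem_nhds ht.1 ht.2)).differentiableAt (by simp)).hasDerivAt
  have hd' : deriv (fun τ => V (γ τ)) t = fderiv ℝ V (γ t) (deriv γ t) :=
    (((hV.differentiable (by simp) (γ t)).hasFDerivAt).comp_hasDerivAt t hd).deriv
  simp only [hd']

/-- The integral of the Jacobian in terms of the boundary values. -/
lemma IsBoundaryParam.integral_jac_eq (hΩ : IsOpen Ω) (hb : Bornology.IsBounded Ω)
    (hγ : IsBoundaryParam Ω γ) {u v g h : ℂ → ℝ} (hu : EqOnBoundary Ω u g)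
    (hv : EqOnBoundary Ω v h) :
    Integrable (fun t => g (γ t) * deriv (fun τ => h (γ τ)) t) (volume.restrict (Ioo (0 : ℝ) 1)) ∧
    ∫ z in Ω, jac Ω u v z = ∫ t in Ioo (0 : ℝ) 1, g (γ t) * deriv (fun τ => h (γ τ)) t := by
  obtain ⟨wu, U, hU, hUg, zu⟩ := hu
  obtain ⟨wv, V, hV, hVh, zv⟩ := hv
  have hmem : ∀ t ∈ Ioo (0 : ℝ) 1, γ t ∈ frontier Ω := fun t ht =>
    hγ.image ▸ mem_image_of_mem γ (Ioo_subset_Icc_self ht)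
  have e : ∀ t ∈ Ioo (0 : ℝ) 1, U (γ t) * deriv (fun τ => V (γ τ)) t
      = g (γ t) * deriv (fun τ => h (γ τ)) t := by
    intro t ht
    -- `V` and `h` agree only on `∂Ω`, which suffices because the derivative is taken along the
    -- curve.
    have hev : (fun τ => V (γ τ)) =ᶠ[𝓝 t] fun τ => h (γ τ) := by
      filter_upwards [Ioo_mem_nhds ht.1 ht.2] with τ hτ
      exact hVh (hmem τ hτ)
    rw [hUg (hmem t ht), hev.deriv_eq]
  refine ⟨(hγ.integrable_mul_deriv hU hV).congr
    ((ae_restrict_iff' measurableSet_Ioo).2 (ae_of_all _ e)), ?_⟩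
  rw [integral_jac_eq_of_sub_memW12Zero hΩ hb hU hV wu wv zu zv, hγ.integral_jac hΩ hb hU hV,
    intervalIntegral.integral_of_le zero_le_one, integral_Ioc_eq_integral_Ioo]
  exact setIntegral_congr_fun measurableSet_Ioo e

/-- With vanishing third derivatives, only index pairs in the first two columns survive, each row
giving a Jacobian. -/
lemma nullDensity_grad (Q : ℂ → Mat3) (z : ℂ) :
    nullDensity (grad Ω Q z) = -2 * (jac Ω (fun w => Q w 0 0) (fun w => Q w 0 1) z
      + jac Ω (fun w => Q w 1 0) (fun w => Q w 1 1) z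
      + jac Ω (fun w => Q w 2 0) (fun w => Q w 2 1) z) := by
  simp only [nullDensity, grad, jac, Fin.sum_univ_three, Matrix.cons_val_zero, Matrix.cons_val_one,
    Matrix.cons_val]
  ring

lemma MemM.integrable_jac {Q₀ Q : ℂ → Mat3} (hQ : MemM Ω Q₀ Q) (i : Fin 3) :
    IntegrableOn (jac Ω (fun w => Q w i 0) (fun w => Q w i 1)) Ω :=
  (hQ i 0).1.integrable_jac (hQ i 1).1

lemma MemM.integral_nullDensity {Q₀ Q : ℂ → Mat3} (hQ : MemM Ω Q₀ Q) :
    ∫ z in Ω, nullDensity (grad Ω Q z) = -2 * ((∫ z in Ω, jac Ω (fun w => Q w 0 0) (fun w => Q w 0 1) z)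
      + (∫ z in Ω, jac Ω (fun w => Q w 1 0) (fun w => Q w 1 1) z)
      + ∫ z in Ω, jac Ω (fun w => Q w 2 0) (fun w => Q w 2 1) z) := by
  simp only [nullDensity_grad]
  rw [integral_const_mul]
  congr 1
  rw [← integral_add (hQ.integrable_jac 0) (hQ.integrable_jac 1)]
  exact integral_add ((hQ.integrable_jac 0).add (hQ.integrable_jac 1)) (hQ.integrable_jac 2)

lemma EqOnBoundary.add_mul (hΩ : IsOpen Ω) {u v g : ℂ → ℝ} (hu : EqOnBoundary Ω u g)
    (hv : MemW12Zero Ω v) (t : ℝ) : EqOnBoundary Ω (fun z => u z + t * v z) g := by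
  obtain ⟨wu, U, hU, hUg, zu⟩ := hu
  refine ⟨by simpa using wu.linear hv.1 1 t, U, hU, hUg, ?_⟩
  have := zu.add_mul hΩ hv t
  convert this using 2
  ring

/-- `Q + tV` keeps the boundary values of `Q`, so the integral is constant in `t` and the first
variation is the derivative of a constant. -/
lemma IsBoundaryParam.isNullLagrangian (hΩ : IsOpen Ω) (hb : Bornology.IsBounded Ω)
    (hγ : IsBoundaryParam Ω γ) (Q₀ : ℂ → Mat3) : IsNullLagrangian Ω Q₀ nullDensity := by
  have hconst : ∀ Q Q', MemM Ω Q₀ Q → MemM Ω Q₀ Q' →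
      ∫ z in Ω, nullDensity (grad Ω Q z) = ∫ z in Ω, nullDensity (grad Ω Q' z) := by
    intro Q Q' hQ hQ'
    rw [hQ.integral_nullDensity, hQ'.integral_nullDensity]
    simp only [(hγ.integral_jac_eq hΩ hb (hQ _ 0) (hQ _ 1)).2,
      (hγ.integral_jac_eq hΩ hb (hQ' _ 0) (hQ' _ 1)).2]
  refine ⟨fun Q hQ => ?_, hconst, fun Q V hQ hV => ?_⟩
  · simp only [nullDensity_grad]
    exact (((hQ.integrable_jac 0).add (hQ.integrable_jac 1)).add (hQ.integrable_jac 2)).const_mul _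
  · have : (fun t : ℝ => ∫ z in Ω, nullDensity (grad Ω (fun w => Q w + t • V w) z))
        = fun _ => ∫ z in Ω, nullDensity (grad Ω Q z) := by
      ext t
      exact hconst _ _ (fun i j => (hQ i j).add_mul hΩ (hV i j) t) hQ
    rw [this]
    exact hasDerivAt_const 0 _

end NullLagrangian

/-! ### The energy densities -/

section Energy

variable {Ω : Set ℂ} {γ : ℝ → ℂ} {s : ℝ} {Q₀ : ℂ → Mat3} {p₁ p₂ r : ℂ → ℝ}

/-- The integral of the Jacobian of `p` in terms of the degree of the boundary datum. -/
lemma MemA0.integral_jac (hΩ : IsOpen Ω) (hb : Bornology.IsBounded Ω) (hγ : IsBoundaryParam Ω γ)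
    (hpr : MemA0 Ω s Q₀ p₁ p₂ r) {d : ℝ} (hdeg : HasDegree s γ Q₀ d) :
    ∫ z in Ω, jac Ω p₁ p₂ z = s ^ 2 * Real.pi * d / 2 := by
  obtain ⟨n₁, n₂, c₁, c₂, hn, hd⟩ := hdeg
  obtain ⟨i1, h1⟩ := hγ.integral_jac_eq hΩ hb hpr.p₁_eq hpr.p₂_eq
  -- Both orders are used to obtain the antisymmetric form `p₁ dp₂ - p₂ dp₁`; unlike `p₁ dp₂` alone,
  -- it is pointwise a multiple of the degree integrand.
  obtain ⟨i2, h2⟩ := hγ.integral_jac_eq hΩ hb hpr.p₂_eq hpr.p₁_eq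
  have hanti : ∫ z in Ω, jac Ω p₂ p₁ z = - ∫ z in Ω, jac Ω p₁ p₂ z := by
    rw [← integral_neg]
    congr 1; ext z; exact jac_swap z
  rw [hanti] at h2
  have hsub := integral_sub i1 i2
  rw [← h1, ← h2] at hsub
  have v1 : ∀ t ∈ Ico (0 : ℝ) 1, (Q₀ (γ t) 0 0 - Q₀ (γ t) 1 1) / 2 = s / 2 * (n₁ t ^ 2 - n₂ t ^ 2) := by
    intro t ht
    rw [(hn t ht).2]
    simp [uniaxial]; ring
  have v2 : ∀ t ∈ Ico (0 : ℝ) 1, Q₀ (γ t) 0 1 = s * (n₁ t * n₂ t) := by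
    intro t ht
    rw [(hn t ht).2]
    simp [uniaxial]
  have key : ∀ t ∈ Ioo (0 : ℝ) 1,
      (Q₀ (γ t) 0 0 - Q₀ (γ t) 1 1) / 2 * deriv (fun τ => Q₀ (γ τ) 0 1) t
        - Q₀ (γ t) 0 1 * deriv (fun τ => (Q₀ (γ τ) 0 0 - Q₀ (γ τ) 1 1) / 2) t
      = s ^ 2 / 2 * (-n₂ t * deriv n₁ t + n₁ t * deriv n₂ t) := by
    intro t ht
    have d1 : HasDerivAt n₁ (deriv n₁ t) t :=
      ((c₁.contDiffAt (Ico_mem_nhds ht.1 ht.2)).differentiableAt (by simp)).hasDerivAt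
    have d2 : HasDerivAt n₂ (deriv n₂ t) t :=
      ((c₂.contDiffAt (Ico_mem_nhds ht.1 ht.2)).differentiableAt (by simp)).hasDerivAt
    have ev1 : (fun τ => (Q₀ (γ τ) 0 0 - Q₀ (γ τ) 1 1) / 2)
        =ᶠ[𝓝 t] fun τ => s / 2 * (n₁ τ ^ 2 - n₂ τ ^ 2) := by
      filter_upwards [Ico_mem_nhds ht.1 ht.2] with τ hτ using v1 τ hτ
    have ev2 : (fun τ => Q₀ (γ τ) 0 1) =ᶠ[𝓝 t] fun τ => s * (n₁ τ * n₂ τ) := by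
      filter_upwards [Ico_mem_nhds ht.1 ht.2] with τ hτ using v2 τ hτ
    have D1 : deriv (fun τ => s / 2 * (n₁ τ ^ 2 - n₂ τ ^ 2)) t
        = s * (n₁ t * deriv n₁ t - n₂ t * deriv n₂ t) := by
      refine (((d1.fun_pow 2).sub (d2.fun_pow 2)).const_mul (s / 2)).deriv.trans ?_
      simp; ring
    have D2 : deriv (fun τ => s * (n₁ τ * n₂ τ)) t
        = s * (deriv n₁ t * n₂ t + n₁ t * deriv n₂ t) :=
      ((d1.mul d2).const_mul s).deriv
    have ht' : t ∈ Ico (0 : ℝ) 1 := ⟨ht.1.le, ht.2⟩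
    rw [ev1.deriv_eq, ev2.deriv_eq, D1, D2, v1 t ht', v2 t ht']
    have hu := (hn t ht').1
    linear_combination (s ^ 2 / 2 * (-n₂ t * deriv n₁ t + n₁ t * deriv n₂ t)) * hu
  rw [setIntegral_congr_fun measurableSet_Ioo key, integral_const_mul] at hsub
  rw [intervalIntegral.integral_of_le zero_le_one, integral_Ioc_eq_integral_Ioo] at hd
  have hpi := Real.pi_ne_zero
  rw [one_div, inv_mul_eq_iff_eq_mul₀ (by positivity)] at hd
  rw [hd] at hsub
  linarith

lemma MemA0.integrable_gb (hb : Bornology.IsBounded Ω)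
    {fb : Mat3 → ℝ} (hfb : IsBulk s fb) (hpr : MemA0 Ω s Q₀ p₁ p₂ r) :
    IntegrableOn (fun z => gb fb (p₁ z ^ 2 + p₂ z ^ 2) (r z)) Ω := by
  have hfin : IsFiniteMeasure (volume.restrict Ω) := ⟨by simpa using hb.measure_lt_top⟩
  obtain ⟨C, hC0, hC⟩ := hfb.growth
  have hpow : ∀ {u g : ℂ → ℝ}, EqOnBoundary Ω u g →
      Integrable (fun z => u z ^ 4) (volume.restrict Ω) := by
    intro u g hu
    have h4 : MemLp u ((4 : ℕ) : ENNReal) (volume.restrict Ω) := by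
      exact_mod_cast hu.memLp_four hb
    refine (h4.integrable_norm_pow (by norm_num)).congr (ae_of_all _ fun z => ?_)
    simp only [Real.norm_eq_abs, Even.pow_abs (by decide : Even 4)]
  have hm : AEStronglyMeasurable (fun z => gb fb (p₁ z ^ 2 + p₂ z ^ 2) (r z))
      (volume.restrict Ω) := by
    simp only [← hfb.fb_Qpr]
    exact hfb.contDiff_fb_Qpr.continuous.comp_aestronglyMeasurable
      (hpr.p₁_eq.1.memLp.1.prodMk (hpr.p₂_eq.1.memLp.1.prodMk hpr.r_eq.1.memLp.1))
  refine Integrable.mono' ((((integrable_const (1 : ℝ)).add (hpow hpr.p₁_eq)).add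
    (hpow hpr.p₂_eq)).add (hpow hpr.r_eq) |>.const_mul C) hm (ae_of_all _ fun z => ?_)
  exact hC _ _ _

lemma integrable_ge (L₁ L₂ L₃ : ℝ) {μ : Measure ℂ} {a b c d e f : ℂ → ℝ} (ha : MemLp a 2 μ)
    (hb : MemLp b 2 μ) (hc : MemLp c 2 μ) (hd : MemLp d 2 μ) (he : MemLp e 2 μ)
    (hf : MemLp f 2 μ) :
    Integrable (fun z => ge L₁ L₂ L₃ (a z) (b z) (c z) (d z) (e z) (f z)) μ := by
  have m : ∀ {u v : ℂ → ℝ}, MemLp u 2 μ → MemLp v 2 μ → Integrable (fun z => u z * v z) μ :=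
    fun hu hv => hu.integrable_mul hv
  have q : ∀ {u : ℂ → ℝ}, MemLp u 2 μ → Integrable (fun z => u z ^ 2) μ := fun hu => hu.integrable_sq
  unfold ge
  exact ((((((q ha).add (q hb)).add (q hc)).add (q hd)).const_mul _).add
    (((q he).add (q hf)).const_mul _)).add
    (((((m ha he).sub (m hb hf)).add (m he hd)).add (m hf hc)).const_mul _) |>.add
    (((m ha hd).sub (m hb hc)).const_mul _)

/-- The weak gradient of `Q(p, r)`. -/
lemma grad_Qpr_ae (hΩ : IsOpen Ω) (w₁ : MemW12 Ω p₁) (wr : MemW12 Ω r)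
    {Q : ℂ → Mat3} (hQ : ∀ z, Q z = Qpr (p₁ z) (p₂ z) (r z)) :
    ∀ᵐ z ∂(volume.restrict Ω), grad Ω Q z =
      ![![![Dx Ω p₁ z + Dx Ω r z / 2, Dy Ω p₁ z + Dy Ω r z / 2, 0], ![Dx Ω p₂ z, Dy Ω p₂ z, 0], 0],
        ![![Dx Ω p₂ z, Dy Ω p₂ z, 0], ![Dx Ω r z / 2 - Dx Ω p₁ z, Dy Ω r z / 2 - Dy Ω p₁ z, 0], 0],
        ![0, 0, ![-Dx Ω r z, -Dy Ω r z, 0]]] := by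
  have q00 : (fun w => Q w 0 0) = fun w => 1 * p₁ w + 1 / 2 * r w := by
    ext w; simp [hQ, Qpr]; ring
  have q11 : (fun w => Q w 1 1) = fun w => (-1) * p₁ w + 1 / 2 * r w := by
    ext w; simp [hQ, Qpr]; ring
  have q22 : (fun w => Q w 2 2) = fun w => 0 * p₁ w + (-1) * r w := by
    ext w; simp [hQ, Qpr]
  have q01 : (fun w => Q w 0 1) = p₂ := by ext w; simp [hQ, Qpr]
  have q10 : (fun w => Q w 1 0) = p₂ := by ext w; simp [hQ, Qpr]
  -- Zero entries are written as combinations too: the chosen weak derivative of `0` vanishes only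
  -- almost everywhere.
  have q02 : (fun w => Q w 0 2) = fun w => 0 * p₁ w + 0 * r w := by ext w; simp [hQ, Qpr]
  have q12 : (fun w => Q w 1 2) = fun w => 0 * p₁ w + 0 * r w := by ext w; simp [hQ, Qpr]
  have q20 : (fun w => Q w 2 0) = fun w => 0 * p₁ w + 0 * r w := by ext w; simp [hQ, Qpr]
  have q21 : (fun w => Q w 2 1) = fun w => 0 * p₁ w + 0 * r w := by ext w; simp [hQ, Qpr]
  filter_upwards [w₁.Dx_linear hΩ wr 1 (1 / 2), w₁.Dy_linear hΩ wr 1 (1 / 2),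
    w₁.Dx_linear hΩ wr (-1) (1 / 2), w₁.Dy_linear hΩ wr (-1) (1 / 2),
    w₁.Dx_linear hΩ wr 0 (-1), w₁.Dy_linear hΩ wr 0 (-1),
    w₁.Dx_linear hΩ wr 0 0, w₁.Dy_linear hΩ wr 0 0] with z a1 a2 a3 a4 a5 a6 a7 a8
  ext i j k
  fin_cases i <;> fin_cases j <;> fin_cases k <;>
    simp only [grad, Fin.zero_eta, Fin.mk_one, Fin.reduceFinMk, q00, q11, q22, q01, q10, q02, q12,
      q20, q21, a1, a2, a3, a4, a5, a6, a7, a8, Matrix.cons_val_zero, Matrix.cons_val_one,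
      Matrix.cons_val, Pi.zero_apply] <;> ring

/-- The first two rows contribute `jac (p₁ + r/2) p₂` and `jac p₂ (r/2 - p₁)`: the terms in `r`
cancel and those in `p` double. -/
lemma MemA0.nullDensity_ae (hΩ : IsOpen Ω) (hpr : MemA0 Ω s Q₀ p₁ p₂ r)
    {Q : ℂ → Mat3} (hQ : ∀ z, Q z = Qpr (p₁ z) (p₂ z) (r z)) :
    ∀ᵐ z ∂(volume.restrict Ω), nullDensity (grad Ω Q z) = -4 * jac Ω p₁ p₂ z := by
  filter_upwards [grad_Qpr_ae hΩ hpr.p₁_eq.1 hpr.r_eq.1 hQ] with z hz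
  rw [hz]
  simp only [nullDensity, jac, Fin.sum_univ_three, Matrix.cons_val_zero, Matrix.cons_val_one,
    Matrix.cons_val, Pi.zero_apply]
  ring

/-- Let `X = Q_{ij,j} Q_{ik,k}` and `Y = Q_{ij,k} Q_{ik,j}`, so `N = Y - X`. Then `(L₂/2) X + (L₃/2)
Y = (L₂+L₃)/4 (X + Y) + (L₃-L₂)/4 N`. Removing the last term leaves the symmetric part, and removing
`|L₂+L₃|/4 N` adds the Jacobian term of `g_e`. -/
lemma MemA0.gDensity_ae (hΩ : IsOpen Ω) (hpr : MemA0 Ω s Q₀ p₁ p₂ r)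
    {fb : Mat3 → ℝ} (hfb : IsBulk s fb) (L₁ L₂ L₃ ε : ℝ)
    {Q : ℂ → Mat3} (hQ : ∀ z, Q z = Qpr (p₁ z) (p₂ z) (r z)) :
    ∀ᵐ z ∂(volume.restrict Ω), gDensity Ω L₁ L₂ L₃ ε fb p₁ p₂ r z
      = fDensity Ω L₁ L₂ L₃ ε fb Q z
        - (L₃ - L₂ + |L₃ + L₂|) / 4 * nullDensity (grad Ω Q z) := by
  filter_upwards [grad_Qpr_ae hΩ hpr.p₁_eq.1 hpr.r_eq.1 hQ] with z hz
  rw [gDensity, fDensity, hz, hQ, hfb.fb_Qpr, add_comm L₃ L₂]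
  simp only [nullDensity, fe, ge, Fin.sum_univ_three, Matrix.cons_val_zero, Matrix.cons_val_one,
    Matrix.cons_val, Pi.zero_apply]
  ring

end Energy

end LdG

/-! ### The energy identity. -/

theorem corollary2p3
    (Ω : Set ℂ) (hΩ : LdG.IsC3Domain Ω)
    (γ : ℝ → ℂ) (hγ : LdG.IsBoundaryParam Ω γ)
    (L₁ L₂ L₃ : ℝ) (hL₁ : 0 < L₁) (hL : 0 < L₁ + L₂ + L₃)
    (s : ℝ) (hs : s ≠ 0) (ε : ℝ) (hε : 0 < ε)
    (fb : LdG.Mat3 → ℝ) (hfb : LdG.IsBulk s fb)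
    (Q₀ : ℂ → LdG.Mat3) (hQ₀ : LdG.IsBoundaryDatum Ω s Q₀)
    (k : ℤ) (hk : 0 < k) (hdeg : LdG.HasDegree s γ Q₀ ((k : ℝ) / 2))
    (p₁ p₂ r : ℂ → ℝ) (hpr : LdG.MemA0 Ω s Q₀ p₁ p₂ r)
    (Q : ℂ → LdG.Mat3) (hQ : ∀ z, Q z = LdG.Qpr (p₁ z) (p₂ z) (r z)) :
    -- the energies are finite
    MeasureTheory.IntegrableOn (LdG.fDensity Ω L₁ L₂ L₃ ε fb Q) Ω ∧
    MeasureTheory.IntegrableOn (LdG.gDensity Ω L₁ L₂ L₃ ε fb p₁ p₂ r) Ω ∧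
    -- the energy identity
    LdG.G Ω L₁ L₂ L₃ ε fb p₁ p₂ r
      = LdG.F Ω L₁ L₂ L₃ ε fb Q + (L₃ - L₂ + |L₃ + L₂|) * (s ^ 2 * Real.pi * k / 4) ∧
    -- the densities differ by a multiple of a null Lagrangian
    (∀ᵐ z ∂(MeasureTheory.volume.restrict Ω),
      LdG.gDensity Ω L₁ L₂ L₃ ε fb p₁ p₂ r z
        = LdG.fDensity Ω L₁ L₂ L₃ ε fb Q z
          - (L₃ - L₂ + |L₃ + L₂|) / 4 * LdG.nullDensity (LdG.grad Ω Q z)) ∧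
    LdG.IsNullLagrangian Ω Q₀ LdG.nullDensity ∧
    -- its integral
    MeasureTheory.IntegrableOn (fun z => LdG.nullDensity (LdG.grad Ω Q z)) Ω ∧
    MeasureTheory.IntegrableOn (LdG.jac Ω p₁ p₂) Ω ∧
    (∫ z in Ω, LdG.nullDensity (LdG.grad Ω Q z)) = -4 * ∫ z in Ω, LdG.jac Ω p₁ p₂ z ∧
    -4 * (∫ z in Ω, LdG.jac Ω p₁ p₂ z) = -(s ^ 2 * Real.pi * k) := by
  have hN := hpr.nullDensity_ae hΩ.isOpen hQ
  have hg := hpr.gDensity_ae hΩ.isOpen hfb L₁ L₂ L₃ ε hQ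
  have iJ : IntegrableOn (LdG.jac Ω p₁ p₂) Ω := hpr.p₁_eq.1.integrable_jac hpr.p₂_eq.1
  have iN : IntegrableOn (fun z => LdG.nullDensity (LdG.grad Ω Q z)) Ω :=
    (Integrable.const_mul iJ (-4)).congr (hN.mono fun _ h => h.symm)
  have iG : IntegrableOn (LdG.gDensity Ω L₁ L₂ L₃ ε fb p₁ p₂ r) Ω :=
    (LdG.integrable_ge L₁ L₂ L₃ hpr.p₁_eq.1.memLp_Dx hpr.p₁_eq.1.memLp_Dy hpr.p₂_eq.1.memLp_Dx
      hpr.p₂_eq.1.memLp_Dy hpr.r_eq.1.memLp_Dx hpr.r_eq.1.memLp_Dy).add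
      (Integrable.const_mul (hpr.integrable_gb hΩ.isBounded hfb) _)
  -- Finiteness of `F_ε` is read off from that of `G_ε` and of `N` through the pointwise relation.
  have iF : IntegrableOn (LdG.fDensity Ω L₁ L₂ L₃ ε fb Q) Ω := by
    refine (Integrable.add iG (Integrable.const_mul iN ((L₃ - L₂ + |L₃ + L₂|) / 4))).congr ?_
    filter_upwards [hg] with z hz
    rw [Pi.add_apply, hz]; ring
  have hJ := hpr.integral_jac hΩ.isOpen hΩ.isBounded hγ hdeg
  have hNJ : (∫ z in Ω, LdG.nullDensity (LdG.grad Ω Q z)) = -4 * ∫ z in Ω, LdG.jac Ω p₁ p₂ z := by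
    rw [integral_congr_ae hN, integral_const_mul]
  refine ⟨iF, iG, ?_, hg, hγ.isNullLagrangian hΩ.isOpen hΩ.isBounded Q₀, iN, iJ, hNJ, ?_⟩
  · rw [LdG.G, LdG.F, integral_congr_ae hg, integral_sub iF (Integrable.const_mul iN _),
      integral_const_mul, hNJ, hJ]
    ring
  · rw [hJ]; ring
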